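/- A mean-payoff parity game is played by two players, Con and Dis, on a finite directed graph with vertex set $V$ in which every vertex has an outgoing edge and is owned by one of the players; every vertex $v$ has a priority $\pi(v)$, a positive integer, and every edge $(v,u)$ has an integer cost $c(v,u)$. The players form an infinite path, the owner of the current vertex choosing the next edge; a strategy may depend on the whole history, a positional one only on the current vertex. The mean payoff of a path with edge costs $c_1,c_2,\dots$ is $\limsup_{n\to\infty}\frac1n\sum_{i=1}^n c_i$. In the game with threshold $\theta$, Con wins a path if the highest priority occurring infinitely often is odd and the mean payoff is $<\theta$; otherwise Dis wins. In the mean-payoff game (without parity), Con wins if the mean payoff is $<0$ and Dis wins if it is $\ge 0$. If no threshold is mentioned, $\theta=0$. A subgame is a non-empty set of vertices whose induced subgraph has no dead end. A trap for a player $P$ in $W\subseteq V$ is a set $X\subseteq W$ such that every edge from a vertex of $P$ in $X$ to a vertex of $W$ leads to $X$, and every vertex of the opponent in $X$ has an edge to a vertex of $X$. A positional reachability strategy for $P$ from $T$ to $B$ in $W$ chooses, at each vertex of $P$ in $T$, an edge inside $W$, so that every play in $W$ that starts in $T$ and follows it stays in $T$ until, after finitely many steps, it reaches $B$. Let $W$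 be a subgame with biggest priority $b$. Decompositions are defined recursively; a component of a partition may be empty unless it is said to be non-empty, and then nothing is required of a decomposition of it. A $b$-decomposition of $W$ for Dis consists of the following. (1) If $b$ is even: a partition of $W$ into $R$, $T$ and $B\neq\emptyset$, where $B$ is the set of vertices of priority $b$ in $W$; a positional reachability strategy for Dis from $T$ to $B$ in $W$; and a $b'$-decomposition of $R$ for Dis with $b'<b$. (2) If $b$ is odd: a partition of $W$ into $U$, $T$ and $R\neq\emptyset$, where $R$ is a trap for Con in $W$; either a $b'$-decomposition of $R$ for Dis with $b'<b$, or a positional strategy for Dis in the game on $R$ that is mean-payoff winning for her from every vertex of $R$; a positional reachability strategy for Dis from $T$ to $R$ in $W$; and a $b''$-decomposition of $U$ for Dis with $b''\le b$. A $b$-decomposition of $W$ for Con consists of the following. (1) If $b$ is odd: a partition of $W$ into $R$, $T$ and $B\neq\emptyset$, where $B$ is the set of vertices of priority $b$ in $W$; a positional reachability strategy for Con from $T$ to $B$ in $W$; a $b'$-decomposition of $R$ for Con with $b'<b$; and a positional strategy for Con in the game on $W$ that is mean-payoff winning for him from every vertex of $W$. (2) If $b$ is even: a partition of $W$ into $U$,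 $T$ and $R\neq\emptyset$, where $R$ is a trap for Dis in $W$; a $b'$-decomposition of $R$ for Con with $b'<b$; a positional reachability strategy for Con from $T$ to $R$ in $W$; and a $b''$-decomposition of $U$ for Con with $b''\le b$. A subgame has a strategy decomposition for a player if it has a $b$-decomposition for that player for some $b$. Theorem. For every mean-payoff parity game there is a partition of $V$ into two (possibly empty) sets $W_{\mathrm{Dis}}$ and $W_{\mathrm{Con}}$ such that $W_{\mathrm{Dis}}$ is a trap for Con in $V$ and $W_{\mathrm{Con}}$ is a trap for Dis in $V$; if $W_{\mathrm{Dis}}\neq\emptyset$, it has a strategy decomposition for Dis; if $W_{\mathrm{Con}}\neq\emptyset$, it has a strategy decomposition for Con; and $W_{\mathrm{Dis}}$ and $W_{\mathrm{Con}}$ are exactly the sets of vertices from which Dis, respectively Con, has a winning strategy in the game with threshold $0$. Moreover, threshold mean-payoff parity games are determined: for every rational threshold $\theta$ and every vertex $v$, exactly one of the two players has a winning strategy from $v$ in the game with threshold $\theta$. -/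

import Mathlib

/-- The two players. -/
inductive Player where
  | con : Player
  | dis : Player

/-- A mean-payoff parity game graph on the vertex set `V`: a directed graph in which every vertex
has an outgoing edge, every vertex has an owner and a positive integer priority, and every edge
`(v, u)` has an integer cost `cost v u` (the value of `cost` on non-edges is irrelevant). -/
structure MeanPayoffParityGame (V : Type*) where
  Edge : V → V → Prop
  owner : V → Player
  priority : V → ℕ
  cost : V → V → ℤ
  exists_edge : ∀ v, ∃ u, Edge v u
  priority_pos : ∀ v, 0 < priority v

namespace MeanPayoffParityGame

variable {V : Type*} (G : MeanPayoffParityGame V)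

/-- `W` is a subgame: a non-empty set of vertices whose induced subgraph has no dead end. -/
def IsSubgame (W : Set V) : Prop :=
  W.Nonempty ∧ ∀ v ∈ W, ∃ u ∈ W, G.Edge v u

/-- `X` is a trap for player `P` in `W`: inside `W`, player `P` cannot leave `X`, and the
opponent of `P` can always stay in `X`. -/
def IsTrap (P : Player) (W X : Set V) : Prop :=
  X ⊆ W ∧ ∀ v ∈ X,
    (G.owner v = P → ∀ u ∈ W, G.Edge v u → u ∈ X) ∧
    (G.owner v ≠ P → ∃ u ∈ X, G.Edge v u)

/-- `p` is an infinite play in `W`. -/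
def IsPlay (W : Set V) (p : ℕ → V) : Prop :=
  ∀ n, p n ∈ W ∧ G.Edge (p n) (p (n + 1))

/-- The mean payoff of a play: the limit superior of the averages of the first `n` edge costs. -/
noncomputable def meanPayoff (p : ℕ → V) : EReal :=
  Filter.limsup
    (fun n : ℕ => ((((∑ i ∈ Finset.range n, G.cost (p i) (p (i + 1)) : ℤ) : ℝ) / (n : ℝ) : ℝ) :
      EReal))
    Filter.atTop

/-- The parity condition: the highest priority that occurs infinitely many times is odd. -/
def ParityOdd (p : ℕ → V) : Prop :=
  ∃ k, Odd k ∧ (∃ᶠ n in Filter.atTop, G.priority (p n) = k) ∧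
    ∀ j, (∃ᶠ n in Filter.atTop, G.priority (p n) = j) → j ≤ k

/-- The play `p` is won by the given player in the mean-payoff parity game with threshold `θ`:
Con wins if the parity condition holds and the mean payoff is less than `θ`; otherwise Dis wins. -/
def WinsPlay (θ : ℚ) (p : ℕ → V) : Player → Prop
  | .con => G.ParityOdd p ∧ G.meanPayoff p < ((θ : ℝ) : EReal)
  | .dis => ¬ (G.ParityOdd p ∧ G.meanPayoff p < ((θ : ℝ) : EReal))

/-- The (zero-threshold) mean-payoff objective of the given player, without parity. -/
def MeanPayoffWinsPlay (p : ℕ → V) : Player → Prop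
  | .con => G.meanPayoff p < 0
  | .dis => 0 ≤ G.meanPayoff p

/-! ### Strategies -/

/-- A strategy `σ` for player `P`: given the sequence `h` of the vertices visited before and the
current vertex `v`, if `P` owns `v` then `σ h v` is a successor of `v`. -/
def IsStrategy (P : Player) (σ : List V → V → V) : Prop :=
  ∀ h v, G.owner v = P → G.Edge v (σ h v)

/-- The sequence `p` follows the strategy `σ` of player `P`. -/
def Follows (P : Player) (σ : List V → V → V) (p : ℕ → V) : Prop :=
  ∀ n, G.owner (p n) = P → p (n + 1) = σ ((List.range n).map p) (p n)

/-- Player `P` has a winning strategy from `v` in the game with threshold `θ`. -/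
def WinsFrom (θ : ℚ) (P : Player) (v : V) : Prop :=
  ∃ σ : List V → V → V, G.IsStrategy P σ ∧
    ∀ p : ℕ → V, G.IsPlay Set.univ p → p 0 = v → G.Follows P σ p → G.WinsPlay θ p P

/-- The winning set of player `P` in the game with threshold `θ`. -/
def winningSet (θ : ℚ) (P : Player) : Set V :=
  {v | G.WinsFrom θ P v}

/-- `τ` is a positional strategy of player `P` defined on the vertices of `P` in `X`, moving along
edges within `W` (its values at all other vertices are irrelevant). -/
def IsPositional (P : Player) (W X : Set V) (τ : V → V) : Prop :=
  ∀ v ∈ X, G.owner v = P → τ v ∈ W ∧ G.Edge v (τ v)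

/-- The sequence `p` follows the positional strategy `τ` of player `P` defined on `X`. -/
def FollowsPositional (P : Player) (X : Set V) (τ : V → V) (p : ℕ → V) : Prop :=
  ∀ n, p n ∈ X → G.owner (p n) = P → p (n + 1) = τ (p n)

/-- `τ` is a positional reachability strategy for `P` from `T` to `B` in `W`: it is defined on `T`,
and every play in `W` that starts in `T` and follows `τ` stays in `T` until it reaches `B`, which
happens after finitely many steps. -/
def IsReachabilityStrategy (P : Player) (W T B : Set V) (τ : V → V) : Prop :=
  G.IsPositional P W T τ ∧
    ∀ p : ℕ → V, G.IsPlay W p → p 0 ∈ T → G.FollowsPositional P T τ p →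
      ∃ n, p n ∈ B ∧ ∀ m < n, p m ∈ T

/-- `τ` is a positional strategy for `P` in the game on `W` that is mean-payoff winning for `P`
from all vertices of `W`. -/
def IsMeanPayoffWinning (P : Player) (W : Set V) (τ : V → V) : Prop :=
  G.IsPositional P W W τ ∧
    ∀ p : ℕ → V, G.IsPlay W p → G.FollowsPositional P W τ p → G.MeanPayoffWinsPlay p P

/-! ### Strategy decompositions -/

/-- The sets `X`, `Y`, `Z` (some of which may be empty) form a partition of `W`. -/
def IsPartition (W X Y Z : Set V) : Prop :=
  X ∪ Y ∪ Z = W ∧ Disjoint X Y ∧ Disjoint X Z ∧ Disjoint Y Z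

/-- `W` is a subgame in which the biggest vertex priority is `b`. -/
def IsSubgameWithTop (b : ℕ) (W : Set V) : Prop :=
  G.IsSubgame W ∧ IsGreatest (G.priority '' W) b

/-- `G.DisDecomposition b W`: there is a `b`-decomposition of `W` for Dis.
A decomposition of a component that may be empty (`R` for even `b`, `U` for odd `b`) is only
asked for when that component is non-empty. For odd `b` the two constructors are the two ways in
which Dis may win on the recurrent part `R`. -/
inductive DisDecomposition : ℕ → Set V → Prop
  | even (b : ℕ) (W R T B : Set V) (τ : V → V) (b' : ℕ)
      (subgame : G.IsSubgameWithTop b W) (parity : Even b)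
      (partition : IsPartition W R T B) (nonempty : B.Nonempty)
      (top : B = {v ∈ W | G.priority v = b})
      (reach : G.IsReachabilityStrategy .dis W T B τ)
      (lt : b' < b) (sub : R.Nonempty → DisDecomposition b' R) :
      DisDecomposition b W
  | oddInduction (b : ℕ) (W U T R : Set V) (τ : V → V) (b' b'' : ℕ)
      (subgame : G.IsSubgameWithTop b W) (parity : Odd b)
      (partition : IsPartition W U T R) (nonempty : R.Nonempty)
      (lt : b' < b) (recurrent : DisDecomposition b' R)
      (reach : G.IsReachabilityStrategy .dis W T R τ)
      (le : b'' ≤ b) (sub : U.Nonempty → DisDecomposition b'' U)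
      (trap : G.IsTrap .con W R) :
      DisDecomposition b W
  | oddMeanPayoff (b : ℕ) (W U T R : Set V) (τ ω : V → V) (b'' : ℕ)
      (subgame : G.IsSubgameWithTop b W) (parity : Odd b)
      (partition : IsPartition W U T R) (nonempty : R.Nonempty)
      (recurrent : G.IsMeanPayoffWinning .dis R ω)
      (reach : G.IsReachabilityStrategy .dis W T R τ)
      (le : b'' ≤ b) (sub : U.Nonempty → DisDecomposition b'' U)
      (trap : G.IsTrap .con W R) :
      DisDecomposition b W

/-- `G.ConDecomposition b W`: there is a `b`-decomposition of `W` for Con.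
A decomposition of a component that may be empty (`R` for odd `b`, `U` for even `b`) is only
asked for when that component is non-empty. -/
inductive ConDecomposition : ℕ → Set V → Prop
  | odd (b : ℕ) (W R T B : Set V) (τ l : V → V) (b' : ℕ)
      (subgame : G.IsSubgameWithTop b W) (parity : Odd b)
      (partition : IsPartition W R T B) (nonempty : B.Nonempty)
      (top : B = {v ∈ W | G.priority v = b})
      (reach : G.IsReachabilityStrategy .con W T B τ)
      (lt : b' < b) (sub : R.Nonempty → ConDecomposition b' R)
      (meanPayoffWinning : G.IsMeanPayoffWinning .con W l) :
      ConDecomposition b W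
  | even (b : ℕ) (W U T R : Set V) (τ : V → V) (b' b'' : ℕ)
      (subgame : G.IsSubgameWithTop b W) (parity : Even b)
      (partition : IsPartition W U T R) (nonempty : R.Nonempty)
      (lt : b' < b) (recurrent : ConDecomposition b' R)
      (reach : G.IsReachabilityStrategy .con W T R τ)
      (le : b'' ≤ b) (sub : U.Nonempty → ConDecomposition b'' U)
      (trap : G.IsTrap .dis W R) :
      ConDecomposition b W

/-- `W` has a strategy decomposition for the given player. -/
def HasStrategyDecomposition (W : Set V) : Player → Prop
  | .con => ∃ b, G.ConDecomposition b W
  | .dis => ∃ b, G.DisDecomposition b W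

end MeanPayoffParityGame

/-! All subgames are solved by induction on their size (`IsSubgame.exists_isSolution`). A solution
splits `W` into two traps, one per player, and each part carries both a strategy decomposition and a
winning strategy with memory (`Wins`). The second is needed because the induction has to know that
the parts are really won, not only that they can be decomposed.

Let `b` be the biggest priority of `W`, and `P` the player favoured by its parity. If `P` also
controls the costs on all of `W` (a condition that is void for Dis), `P` attracts to the vertices of
priority `b` and the rest is solved by induction. If `P` wins the rest, then `P` wins `W` by
alternating between the attractor, the strategy on the rest and long stretches of the mean-payoff
strategy (`Wins.of_top`). Otherwise the opponent wins a non-empty trap of smaller priorities. If `b`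
is odd and Con does not control the costs, Dis wins the mean-payoff game on a non-empty trap
(`IsSubgame.meanPayoff_dichotomy`). In both remaining cases the player disfavoured by `b` wins a
non-empty trap, whose attractor is removed before recursing (`exists_isSolution_of_trap`).

The dichotomy is positional determinacy of mean-payoff games, expressed by potentials: it is
explicit when every vertex has one edge, and the general case follows by splitting the edges of one
vertex at a time. Potentials also carry Con's payoff through compositions of strategies: a bounded
function that drops in each step by at least the cost plus `ε` forces a negative mean payoff.
Nonzero thresholds are removed by rescaling the costs. -/

/-! ### Potentials and positional determinacy of mean-payoff games -/

open Classical in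
/-- On a finite graph with one edge per vertex, the cost of an edge is a potential difference plus
a quantity that is constant along the edges. -/
theorem exists_poisson {V : Type*} [Finite V] (f : V → V) (c : V → ℝ) :
    ∃ h s : V → ℝ, (∀ x, s (f x) = s x) ∧ ∀ x, c x + h (f x) = h x + s x := by
  obtain ⟨i, j, hij, hf⟩ : ∃ i j : ℕ, i < j ∧ f^[i] = f^[j] := by
    obtain ⟨i, j, hne, h⟩ := Finite.exists_ne_map_eq_of_infinite (fun n : ℕ => f^[n])
    rcases lt_or_gt_of_ne hne with h' | h'
    · exact ⟨i, j, h', h⟩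
    · exact ⟨j, i, h', h.symm⟩
  obtain ⟨d, rfl⟩ := Nat.exists_eq_add_of_lt hij
  set k := d + 1 with hk
  have hk0 : (k : ℝ) ≠ 0 := by positivity
  let S : ℕ → V → ℝ := fun n x => ∑ t ∈ Finset.range n, c (f^[t] x)
  have hS : ∀ n x, S n (f x) = S (n + 1) x - c x := by
    intro n x
    simp only [S, Finset.sum_range_succ', Function.iterate_succ_apply, Function.iterate_zero, id]
    ring
  have hS' : ∀ n x, S (n + 1) x = S n x + c (f^[n] x) := fun n x => Finset.sum_range_succ _ _
  -- The mean cost of the cycle that is eventually reached from `x`: after `i` steps the orbit is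
  -- periodic with period `k`.
  let s : V → ℝ := fun x => (S (i + k) x - S i x) / k
  have hs : ∀ x, s (f x) = s x := by
    intro x
    have : f^[i] x = f^[i + k] x := congrFun hf x
    simp only [s, hS, hS', this]
    ring
  let D : ℕ → V → ℝ := fun n x => S n x - n * s x
  have hD : ∀ x, D (i + k) x = D i x := by
    intro x
    simp only [D, s]
    push_cast
    field_simp
    ring
  -- Passing from `x` to `f x` shifts the index of `D` by one, up to `c x` and `s x`. Averaging over
  -- a full period makes the shift disappear, because `D (i + k) = D i`.
  refine ⟨fun x => (∑ t ∈ Finset.range k, D (i + t) x) / k, s, hs, fun x => ?_⟩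
  have h1 : ∀ n, D n (f x) = D (n + 1) x - c x + s x := by
    intro n
    simp only [D, hS, hs]
    push_cast
    ring
  have h2 : ∑ t ∈ Finset.range k, D (i + t + 1) x = ∑ t ∈ Finset.range k, D (i + t) x := by
    have e1 := Finset.sum_range_succ (fun t => D (i + t) x) k
    have e2 := Finset.sum_range_succ' (fun t => D (i + t) x) k
    simp only [hD, add_zero] at e1 e2
    simp only [add_assoc]
    linarith
  have h3 : ∑ t ∈ Finset.range k, D (i + t) (f x)
      = ∑ t ∈ Finset.range k, D (i + t) x - k * c x + k * s x := by
    simp only [h1, Finset.sum_add_distrib, Finset.sum_sub_distrib, h2]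
    simp
  simp only [h3]
  field_simp
  ring

/-- `h` is a potential on `X` showing that the player who owns the vertices in `own` can stay in
`X` along edges whose weight is at least the drop of `h`. -/
def IsPotential {V : Type*} (own : V → Prop) (S : V → Finset V) (w : V → V → ℝ) (X : Set V)
    (h : V → ℝ) : Prop :=
  ∀ x ∈ X, (own x → ∃ u ∈ S x, u ∈ X ∧ h x ≤ w x u + h u) ∧
    (¬ own x → ∀ u ∈ S x, u ∈ X ∧ h x ≤ w x u + h u)

/-- The vertices split into two sets on which the two players have potentials. -/
def PotentialDetermined {V : Type*} (own : V → Prop) (w₁ w₂ : V → V → ℝ) (S : V → Finset V) :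
    Prop :=
  ∃ X : Set V, (∃ h, IsPotential own S w₁ X h) ∧ ∃ g, IsPotential (fun x => ¬ own x) S w₂ Xᶜ g

/-! ### Comparing and gluing potentials. -/

namespace IsPotential

variable {V : Type*} {own : V → Prop} {S S₁ S₂ : V → Finset V} {w w₁ w₂ : V → V → ℝ}
  {X X₁ X₂ : Set V} {h h₁ h₂ : V → ℝ}

theorem of_eqOn (hp : IsPotential own S₁ w X h) (hS : ∀ x ∈ X, S x = S₁ x) :
    IsPotential own S w X h := by
  intro x hx
  rw [hS x hx]
  exact hp x hx

theorem of_subset (hp : IsPotential own S₁ w X h) (hS : ∀ x ∈ X, ¬ own x → S x = S₁ x)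
    (hS' : ∀ x, S₁ x ⊆ S x) : IsPotential own S w X h := by
  intro x hx
  refine ⟨fun ho => ?_, fun ho => ?_⟩
  · obtain ⟨u, hu, h'⟩ := (hp x hx).1 ho
    exact ⟨u, hS' x hu, h'⟩
  · rw [hS x hx ho]
    exact (hp x hx).2 ho

/-- At a maximum of `h₁ + h₂` on the intersection, the owner of the vertex follows the edge provided
by the owner's potential, and the other potential allows every edge. Adding the two inequalities
gives a strictly larger value at the successor. -/
theorem disjoint [Finite V] (h₁p : IsPotential own S₁ w₁ X₁ h₁)
    (h₂p : IsPotential (fun x => ¬ own x) S₂ w₂ X₂ h₂) (hw : ∀ x u, w₁ x u + w₂ x u < 0)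
    (hS : ∀ x ∈ X₁, x ∈ X₂ → S₁ x = S₂ x) : Disjoint X₁ X₂ := by
  rw [Set.disjoint_iff_inter_eq_empty]
  by_contra hne
  obtain ⟨x, ⟨hx₁, hx₂⟩, hmax⟩ := Set.exists_max_image (X₁ ∩ X₂) (fun x => h₁ x + h₂ x)
    (Set.toFinite _) (Set.nonempty_iff_ne_empty.2 hne)
  have key : ∃ u, (u ∈ X₁ ∧ h₁ x ≤ w₁ x u + h₁ u) ∧ (u ∈ X₂ ∧ h₂ x ≤ w₂ x u + h₂ u) := by
    by_cases ho : own x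
    · obtain ⟨u, hu, h'⟩ := (h₁p x hx₁).1 ho
      exact ⟨u, h', (h₂p x hx₂).2 (not_not.2 ho) u (hS x hx₁ hx₂ ▸ hu)⟩
    · obtain ⟨u, hu, h'⟩ := (h₂p x hx₂).1 ho
      exact ⟨u, (h₁p x hx₁).2 ho u (hS x hx₁ hx₂ ▸ hu), h'⟩
  obtain ⟨u, ⟨hu₁, h1⟩, hu₂, h2⟩ := key
  have := hmax u ⟨hu₁, hu₂⟩
  have := hw x u
  linarith

-- Both potentials are normalised to vanish at `v`, and their pointwise maximum is taken, with `⊥`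
-- as minus infinity off the respective set. Away from `v` the potential that attains the maximum
-- supplies the inequality; at `v` both attain it, so the edges of both parts are covered.
open Classical in
theorem merge {v : V} (h₁p : IsPotential own S₁ w X₁ h₁) (h₂p : IsPotential own S₂ w X₂ h₂)
    (ho : ¬ own v) (hv₁ : v ∈ X₁) (hv₂ : v ∈ X₂) (hS₁ : ∀ x ≠ v, S x = S₁ x)
    (hS₂ : ∀ x ≠ v, S x = S₂ x) (hSv : ∀ u ∈ S v, u ∈ S₁ v ∨ u ∈ S₂ v) :
    ∃ h, IsPotential own S w (X₁ ∪ X₂) h := by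
  let a₁ : V → WithBot ℝ := fun x => if x ∈ X₁ then ((h₁ x - h₁ v : ℝ) : WithBot ℝ) else ⊥
  let a₂ : V → WithBot ℝ := fun x => if x ∈ X₂ then ((h₂ x - h₂ v : ℝ) : WithBot ℝ) else ⊥
  let h : V → ℝ := fun x => (a₁ x ⊔ a₂ x).unbotD 0
  have le₁ : ∀ x ∈ X₁, h₁ x - h₁ v ≤ h x := by
    intro x hx
    by_cases hx' : x ∈ X₂ <;> simp [h, a₁, a₂, hx, hx', ← WithBot.coe_sup]
  have le₂ : ∀ x ∈ X₂, h₂ x - h₂ v ≤ h x := by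
    intro x hx
    by_cases hx' : x ∈ X₁ <;> simp [h, a₁, a₂, hx, hx', ← WithBot.coe_sup]
  have cases : ∀ x ∈ X₁ ∪ X₂, (x ∈ X₁ ∧ h x = h₁ x - h₁ v) ∨ (x ∈ X₂ ∧ h x = h₂ x - h₂ v) := by
    intro x hx
    by_cases hx₁ : x ∈ X₁ <;> by_cases hx₂ : x ∈ X₂
    · rcases le_total (h₁ x - h₁ v) (h₂ x - h₂ v) with hle | hle
      · exact Or.inr ⟨hx₂, by simp [h, a₁, a₂, hx₁, hx₂, hle]⟩
      · exact Or.inl ⟨hx₁, by simp [h, a₁, a₂, hx₁, hx₂, hle]⟩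
    · exact Or.inl ⟨hx₁, by simp [h, a₁, a₂, hx₁, hx₂]⟩
    · exact Or.inr ⟨hx₂, by simp [h, a₁, a₂, hx₁, hx₂]⟩
    · exact absurd hx (by simp [hx₁, hx₂])
  have hv : h v = 0 := by
    rcases cases v (Or.inl hv₁) with h' | h' <;> simpa using h'.2
  refine ⟨h, fun x hx => ?_⟩
  by_cases hxv : x = v
  · subst hxv
    refine ⟨fun h' => absurd h' ho, fun _ u hu => ?_⟩
    rcases hSv u hu with hu' | hu'
    · obtain ⟨h1, h2⟩ := (h₁p x hv₁).2 ho u hu'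
      have := le₁ u h1
      exact ⟨Or.inl h1, by linarith⟩
    · obtain ⟨h1, h2⟩ := (h₂p x hv₂).2 ho u hu'
      have := le₂ u h1
      exact ⟨Or.inr h1, by linarith⟩
  · rcases cases x hx with ⟨hx', he⟩ | ⟨hx', he⟩
    · rw [hS₁ x hxv, he]
      refine ⟨fun ho => ?_, fun ho u hu => ?_⟩
      · obtain ⟨u, hu, h1, h2⟩ := (h₁p x hx').1 ho
        have := le₁ u h1
        exact ⟨u, hu, Or.inl h1, by linarith⟩
      · obtain ⟨h1, h2⟩ := (h₁p x hx').2 ho u hu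
        have := le₁ u h1
        exact ⟨Or.inl h1, by linarith⟩
    · rw [hS₂ x hxv, he]
      refine ⟨fun ho => ?_, fun ho u hu => ?_⟩
      · obtain ⟨u, hu, h1, h2⟩ := (h₂p x hx').1 ho
        have := le₂ u h1
        exact ⟨u, hu, Or.inr h1, by linarith⟩
      · obtain ⟨h1, h2⟩ := (h₂p x hx').2 ho u hu
        have := le₂ u h1
        exact ⟨Or.inr h1, by linarith⟩

end IsPotential

/-! ### Determinacy by splitting the edges at a vertex. -/

namespace PotentialDetermined

variable {V : Type*} {own : V → Prop} {S S₁ S₂ : V → Finset V} {w₁ w₂ : V → V → ℝ}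

theorem symm (hd : PotentialDetermined own w₁ w₂ S) :
    PotentialDetermined (fun x => ¬ own x) w₂ w₁ S := by
  obtain ⟨X, hX, hY⟩ := hd
  exact ⟨Xᶜ, hY, by simpa using hX⟩

/-- The second player owns `v`. If `v` lies outside `X₁` or `X₂`, that player already has a good
edge at `v` in the corresponding smaller graph, and the partition of that graph remains valid. If
`v` lies in both, `disjoint` gives `X₁ ⊆ X₂`, so `merge` yields a potential on `X₂`, while the
complement of `X₂` does not see the new edges. -/
theorem of_split [Finite V] {v : V} (hw : ∀ x u, w₁ x u + w₂ x u < 0) (ho : ¬ own v)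
    (hd₁ : PotentialDetermined own w₁ w₂ S₁) (hd₂ : PotentialDetermined own w₁ w₂ S₂)
    (hS₁ : ∀ x ≠ v, S x = S₁ x) (hS₂ : ∀ x ≠ v, S x = S₂ x)
    (hSv : ∀ u, u ∈ S v ↔ u ∈ S₁ v ∨ u ∈ S₂ v) : PotentialDetermined own w₁ w₂ S := by
  have sub₁ : ∀ x, S₁ x ⊆ S x := fun x => by
    by_cases hx : x = v
    · subst hx; exact fun u hu => (hSv u).2 (Or.inl hu)
    · rw [hS₁ x hx]
  have sub₂ : ∀ x, S₂ x ⊆ S x := fun x => by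
    by_cases hx : x = v
    · subst hx; exact fun u hu => (hSv u).2 (Or.inr hu)
    · rw [hS₂ x hx]
  obtain ⟨X₁, ⟨h₁, hX₁⟩, g₁, hY₁⟩ := hd₁
  obtain ⟨X₂, ⟨h₂, hX₂⟩, g₂, hY₂⟩ := hd₂
  by_cases hv₁ : v ∈ X₁
  · by_cases hv₂ : v ∈ X₂
    · have hdisj : Disjoint X₁ X₂ᶜ := by
        refine hX₁.disjoint hY₂ hw fun x _ hx => ?_
        have hxv : x ≠ v := fun e => hx (e ▸ hv₂)
        rw [← hS₁ x hxv, hS₂ x hxv]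
      have hun : X₁ ∪ X₂ = X₂ := Set.union_eq_right.2 (Set.disjoint_compl_right_iff_subset.1 hdisj)
      refine ⟨X₂, ?_, g₂, hY₂.of_eqOn fun x hx => hS₂ x fun e => hx (e ▸ hv₂)⟩
      have := hX₁.merge hX₂ ho hv₁ hv₂ hS₁ hS₂ fun u => (hSv u).1
      rwa [hun] at this
    · refine ⟨X₂, ⟨h₂, hX₂.of_eqOn fun x hx => hS₂ x fun e => hv₂ (e ▸ hx)⟩, g₂,
        hY₂.of_subset (fun x _ hx => hS₂ x fun e => hx (e ▸ ho)) sub₂⟩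
  · refine ⟨X₁, ⟨h₁, hX₁.of_eqOn fun x hx => hS₁ x fun e => hv₁ (e ▸ hx)⟩, g₁,
      hY₁.of_subset (fun x _ hx => hS₁ x fun e => hx (e ▸ ho)) sub₁⟩

-- Induction on the number of edges: at a vertex with at least two edges, one edge is separated from
-- the others. Exchanging the players by `symm` covers both owners.
open Classical in
theorem of_functional [Finite V] (hw : ∀ x u, w₁ x u + w₂ x u < 0)
    (base : ∀ f : V → V, PotentialDetermined own w₁ w₂ fun x => {f x}) (S : V → Finset V)
    (hS : ∀ x, (S x).Nonempty) : PotentialDetermined own w₁ w₂ S := by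
  have := Fintype.ofFinite V
  induction hn : ∑ x, (S x).card using Nat.strong_induction_on generalizing S with
  | _ n ih =>
  by_cases hone : ∀ x, (S x).card = 1
  · choose f hf using fun x => Finset.card_eq_one.1 (hone x)
    have : S = fun x => {f x} := funext hf
    rw [this]
    exact base f
  · push Not at hone
    obtain ⟨v, hv⟩ := hone
    have hv2 : 1 < (S v).card := lt_of_le_of_ne (hS v).card_pos (Ne.symm hv)
    obtain ⟨a, ha⟩ := hS v
    have aux : ∀ A : Finset V, A ⊂ S v → A.Nonempty →
        PotentialDetermined own w₁ w₂ (Function.update S v A) := by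
      intro A hA hne
      refine ih _ ?_ _ ?_ rfl
      · rw [← hn]
        refine Finset.sum_lt_sum (fun x _ => ?_) ⟨v, Finset.mem_univ _, ?_⟩
        · by_cases hx : x = v
          · subst hx; simpa using Finset.card_le_card hA.subset
          · simp [hx]
        · simpa using Finset.card_lt_card hA
      · intro x
        by_cases hx : x = v
        · subst hx; simpa using hne
        · simpa [hx] using hS x
    have d₁ := aux {a} ((Finset.ssubset_iff_subset_ne).2
      ⟨by simpa using ha, fun e => by rw [← e] at hv2; simp at hv2⟩) (by simp)
    have d₂ := aux ((S v).erase a) (Finset.erase_ssubset ha) (by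
      rw [← Finset.card_pos, Finset.card_erase_of_mem ha]; omega)
    have e₁ : ∀ A : Finset V, ∀ x ≠ v, S x = Function.update S v A x := by
      intro A x hx; simp [hx]
    have e₂ : ∀ u, u ∈ S v ↔ u ∈ Function.update S v {a} v ∨
        u ∈ Function.update S v ((S v).erase a) v := by
      intro u
      by_cases hu : u = a <;> simp [hu, ha]
    by_cases ho : own v
    · have := (of_split (own := fun x => ¬ own x) (fun x u => by rw [add_comm]; exact hw x u)
        (not_not.2 ho) d₁.symm d₂.symm (e₁ _) (e₁ _) e₂).symm
      simpa using this
    · exact of_split hw ho d₁ d₂ (e₁ _) (e₁ _) e₂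

end PotentialDetermined

/-- Positional determinacy of mean-payoff games, in terms of potentials. -/
theorem exists_potentialDetermined {V : Type*} [Finite V] (own : V → Prop) (c : V → V → ℝ)
    (S : V → Finset V) (hS : ∀ x, (S x).Nonempty) :
    ∃ ε : ℝ, 0 < ε ∧ PotentialDetermined own c (fun x u => -c x u - ε) S := by
  have base : ∀ᶠ ε : ℝ in nhdsWithin 0 (Set.Ioi 0), ∀ f : V → V,
      PotentialDetermined own c (fun x u => -c x u - ε) fun x => {f x} := by
    refine Filter.eventually_all.2 fun f => ?_
    obtain ⟨h, s, hs, hp⟩ := exists_poisson f fun x => c x (f x)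
    -- There are finitely many graphs with one edge per vertex and finitely many cycle means in
    -- each, so a single `ε` separates all negative means from zero.
    have : ∀ᶠ ε : ℝ in nhdsWithin 0 (Set.Ioi 0), ∀ x, s x < 0 → s x ≤ -ε := by
      refine Filter.eventually_all.2 fun x => ?_
      by_cases hx : s x < 0
      · filter_upwards [Ioo_mem_nhdsGT (neg_pos.2 hx)] with ε hε _
        linarith [hε.2]
      · exact Filter.Eventually.of_forall fun ε h' => absurd h' hx
    filter_upwards [this] with ε hε
    refine ⟨{x | 0 ≤ s x}, ⟨h, fun x hx => ?_⟩, fun x => -h x, fun x hx => ?_⟩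
    · have := hp x
      simp only [Set.mem_ofPred_eq] at hx
      simp only [Finset.mem_singleton, forall_eq, exists_eq_left, Set.mem_ofPred_eq, hs]
      have : h x ≤ c x (f x) + h (f x) := by linarith
      simp [hx, this]
    · have := hp x
      simp only [Set.mem_compl_iff, Set.mem_ofPred_eq, not_le] at hx
      have := hε x hx
      simp only [Finset.mem_singleton, forall_eq, exists_eq_left, Set.mem_compl_iff,
        Set.mem_ofPred_eq, hs, not_le]
      have : -h x ≤ -c x (f x) - ε + -h (f x) := by linarith
      simp [hx, this]
  obtain ⟨ε, hε, hb⟩ := (eventually_mem_nhdsWithin.and base).exists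
  exact ⟨ε, hε, .of_functional (fun x u => by simp only [Set.mem_Ioi] at hε; linarith) hb S hS⟩

namespace MeanPayoffParityGame

variable {V : Type*} (G : MeanPayoffParityGame V)

/-! ### Payoffs and objectives -/

/-- A slope strictly between the limsup and `θ` bounds all late terms, and `K` absorbs the finitely
many early ones. Conversely, half of the margin `ε` eventually outweighs `K`. -/
theorem limsup_div_lt_iff (s : ℕ → ℝ) (θ : ℝ) :
    Filter.limsup (fun n : ℕ => ((s n / (n : ℝ) : ℝ) : EReal)) Filter.atTop < (θ : EReal) ↔
      ∃ ε : ℝ, 0 < ε ∧ ∃ K : ℝ, ∀ n : ℕ, s n ≤ K + (θ - ε) * n := by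
  constructor
  · intro h
    obtain ⟨a, ha, haθ⟩ := EReal.lt_iff_exists_real_btwn.1 h
    have haθ' : a < θ := EReal.coe_lt_coe_iff.1 haθ
    have hev := Filter.eventually_lt_of_limsup_lt ha
    obtain ⟨N, hN⟩ := Filter.eventually_atTop.1 hev
    refine ⟨θ - a, by linarith, ∑ i ∈ Finset.range (N + 1), |s i - a * i|, fun n => ?_⟩
    have hpos : 0 ≤ ∑ i ∈ Finset.range (N + 1), |s i - a * i| :=
      Finset.sum_nonneg fun _ _ => abs_nonneg _
    rw [sub_sub_cancel]
    by_cases hn : n < N + 1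
    · have := Finset.single_le_sum (f := fun i : ℕ => |s i - a * i|) (fun _ _ => abs_nonneg _)
        (Finset.mem_range.2 hn)
      have h2 := le_abs_self (s n - a * n)
      linarith
    · have hn0 : (0 : ℝ) < n := by
        have : 0 < n := by omega
        exact_mod_cast this
      have := EReal.coe_lt_coe_iff.1 (hN n (by omega))
      rw [div_lt_iff₀ hn0] at this
      linarith
  · rintro ⟨ε, hε, K, hK⟩
    have : Filter.limsup (fun n : ℕ => ((s n / (n : ℝ) : ℝ) : EReal)) Filter.atTop
        ≤ ((θ - ε / 2 : ℝ) : EReal) := by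
      refine Filter.limsup_le_of_le (by isBoundedDefault) ?_
      obtain ⟨N, hN⟩ := exists_nat_gt (K / (ε / 2))
      filter_upwards [Filter.eventually_ge_atTop (N + 1)] with n hn
      have hn0 : (0 : ℝ) < n := by
        have : 0 < n := by omega
        exact_mod_cast this
      rw [EReal.coe_le_coe_iff, div_le_iff₀ hn0]
      rw [div_lt_iff₀ (by linarith)] at hN
      have hNn : (N : ℝ) ≤ n := by
        have : N ≤ n := by omega
        exact_mod_cast this
      have := hK n
      nlinarith
    exact this.trans_lt (EReal.coe_lt_coe_iff.2 (by linarith))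

/-- The mean payoff is below `θ` if and only if the partial sums of the costs are bounded above by
an affine function of slope less than `θ`. -/
theorem meanPayoff_lt_iff (p : ℕ → V) (θ : ℝ) :
    G.meanPayoff p < (θ : EReal) ↔ ∃ ε : ℝ, 0 < ε ∧ ∃ K : ℝ, ∀ n : ℕ,
      ∑ i ∈ Finset.range n, (G.cost (p i) (p (i + 1)) : ℝ) ≤ K + (θ - ε) * n := by
  rw [← limsup_div_lt_iff]
  simp only [meanPayoff, Int.cast_sum]

theorem meanPayoff_neg_iff (p : ℕ → V) :
    G.meanPayoff p < 0 ↔ ∃ ε : ℝ, 0 < ε ∧ ∃ K : ℝ, ∀ n : ℕ,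
      ∑ i ∈ Finset.range n, (G.cost (p i) (p (i + 1)) : ℝ) ≤ K - ε * n := by
  have := G.meanPayoff_lt_iff p 0
  simp only [EReal.coe_zero, zero_sub, neg_mul, ← sub_eq_add_neg] at this
  exact this

variable {G}

theorem meanPayoff_neg_of_potential {p : ℕ → V} {Φ : ℕ → ℝ} {ε K : ℝ} (hε : 0 < ε)
    (h0 : ∀ n, -K ≤ Φ n) (h : ∀ n, G.cost (p n) (p (n + 1)) + ε + Φ (n + 1) ≤ Φ n) :
    G.meanPayoff p < 0 := by
  refine (G.meanPayoff_neg_iff p).2 ⟨ε, hε, Φ 0 + K, fun n => ?_⟩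
  have : ∑ i ∈ Finset.range n, (G.cost (p i) (p (i + 1)) : ℝ) ≤ Φ 0 - Φ n - ε * n := by
    induction n with
    | zero => simp
    | succ n ih =>
      rw [Finset.sum_range_succ]
      have := h n
      push_cast
      linarith
  linarith [h0 n]

theorem meanPayoff_nonneg_of_potential {p : ℕ → V} {Φ : ℕ → ℝ} {K : ℝ}
    (h0 : ∀ n, -K ≤ Φ n) (h1 : ∀ n, Φ n ≤ K)
    (h : ∀ n, Φ n ≤ G.cost (p n) (p (n + 1)) + Φ (n + 1)) : 0 ≤ G.meanPayoff p := by
  by_contra hlt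
  obtain ⟨ε, hε, K', hK'⟩ := (G.meanPayoff_neg_iff p).1 (not_le.1 hlt)
  have hsum : ∀ n, Φ 0 - Φ n ≤ ∑ i ∈ Finset.range n, (G.cost (p i) (p (i + 1)) : ℝ) := by
    intro n
    induction n with
    | zero => simp
    | succ n ih =>
      rw [Finset.sum_range_succ]
      have := h n
      linarith
  obtain ⟨n, hn⟩ := exists_nat_gt ((K' + 2 * K) / ε)
  rw [div_lt_iff₀ hε] at hn
  have := hsum n
  have := hK' n
  linarith [h0 0, h1 n]

theorem meanPayoff_shift_neg {p : ℕ → V} (N : ℕ) (h : G.meanPayoff p < 0) :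
    G.meanPayoff (fun n => p (n + N)) < 0 := by
  obtain ⟨ε, hε, K, hK⟩ := (G.meanPayoff_neg_iff p).1 h
  refine (G.meanPayoff_neg_iff _).2
    ⟨ε, hε, K - ∑ i ∈ Finset.range N, (G.cost (p i) (p (i + 1)) : ℝ), fun n => ?_⟩
  have h1 := hK (N + n)
  rw [Finset.sum_range_add] at h1
  have h2 : ∀ i, G.cost (p (i + N)) (p (i + 1 + N)) = G.cost (p (N + i)) (p (N + i + 1)) := by
    intro i
    congr 2 <;> ring
  simp only [h2]
  push_cast at h1
  have : 0 ≤ ε * N := by positivity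
  linarith

theorem frequently_shift {P : ℕ → Prop} (N : ℕ) :
    (∃ᶠ n in Filter.atTop, P (n + N)) ↔ ∃ᶠ n in Filter.atTop, P n := by
  conv_rhs => rw [← Filter.map_add_atTop_eq_nat N]
  exact Filter.frequently_map.symm

theorem parityOdd_shift {p : ℕ → V} (N : ℕ) :
    G.ParityOdd (fun n => p (n + N)) ↔ G.ParityOdd p := by
  have h := fun k => frequently_shift (P := fun n => G.priority (p n) = k) N
  simp only [ParityOdd, h]

theorem parityOdd_iff_of_frequently_top {p : ℕ → V} {b : ℕ} (hle : ∀ n, G.priority (p n) ≤ b)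
    (hb : ∃ᶠ n in Filter.atTop, G.priority (p n) = b) : G.ParityOdd p ↔ Odd b := by
  constructor
  · rintro ⟨k, hk, hfreq, hmax⟩
    obtain ⟨n, hn⟩ := hfreq.exists
    have : k = b := le_antisymm (hn ▸ hle n) (hmax b hb)
    exact this ▸ hk
  · intro hodd
    refine ⟨b, hodd, hb, fun j hj => ?_⟩
    obtain ⟨n, hn⟩ := hj.exists
    exact hn ▸ hle n

variable (G) in
/-- The prefix-independent part of the winning condition of a player: parity for Con, the whole
winning condition with threshold zero for Dis. -/
def Objective : Player → (ℕ → V) → Prop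
  | .con, p => G.ParityOdd p
  | .dis, p => ¬ (G.ParityOdd p ∧ G.meanPayoff p < 0)

theorem Objective.of_shift {P : Player} {p : ℕ → V} (N : ℕ)
    (h : G.Objective P fun n => p (n + N)) : G.Objective P p := by
  cases P with
  | con => exact (parityOdd_shift N).1 h
  | dis => exact fun h' => h ⟨(parityOdd_shift N).2 h'.1, meanPayoff_shift_neg N h'.2⟩

/-- The parities that are good for a player. -/
def GoodParity : Player → ℕ → Prop
  | .con, b => Odd b
  | .dis, b => Even b

theorem Objective.of_frequently_top {P : Player} {p : ℕ → V} {b : ℕ} (hP : GoodParity P b)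
    (hle : ∀ n, G.priority (p n) ≤ b)
    (hb : ∃ᶠ n in Filter.atTop, G.priority (p n) = b) : G.Objective P p := by
  cases P with
  | con => exact (parityOdd_iff_of_frequently_top hle hb).2 hP
  | dis => exact fun h => Nat.not_odd_iff_even.2 hP ((parityOdd_iff_of_frequently_top hle hb).1 h.1)

/-! ### Reduction to the threshold zero -/

variable (G) in
/-- The game with costs rescaled so that the threshold `θ` becomes zero. -/
def shiftThreshold (θ : ℚ) : MeanPayoffParityGame V where
  Edge := G.Edge
  owner := G.owner
  priority := G.priority
  cost v u := θ.den * G.cost v u - θ.num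
  exists_edge := G.exists_edge
  priority_pos := G.priority_pos

/-- The new cost is `θ.den * (c - θ)`, so the constants `ε` and `K` of the affine bounds only change
by the factor `θ.den`. -/
theorem meanPayoff_shiftThreshold_neg (θ : ℚ) (p : ℕ → V) :
    (G.shiftThreshold θ).meanPayoff p < 0 ↔ G.meanPayoff p < ((θ : ℝ) : EReal) := by
  rw [meanPayoff_neg_iff, meanPayoff_lt_iff]
  have hd : (0 : ℝ) < θ.den := by exact_mod_cast θ.den_pos
  have hθ : (θ.num : ℝ) = θ.den * θ := by
    have := Rat.den_mul_eq_num θ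
    exact_mod_cast this.symm
  have hsum : ∀ n, ∑ i ∈ Finset.range n, ((G.shiftThreshold θ).cost (p i) (p (i + 1)) : ℝ)
      = θ.den * ((∑ i ∈ Finset.range n, (G.cost (p i) (p (i + 1)) : ℝ)) - θ * n) := by
    intro n
    simp only [shiftThreshold]
    push_cast
    rw [Finset.sum_sub_distrib, ← Finset.mul_sum, hθ]
    simp only [Finset.sum_const, Finset.card_range, nsmul_eq_mul]
    ring
  simp only [hsum]
  constructor
  · rintro ⟨ε, hε, K, hK⟩
    refine ⟨ε / θ.den, by positivity, K / θ.den, fun n => ?_⟩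
    have := hK n
    rw [mul_comm, ← le_div_iff₀ hd] at this
    have e : (K - ε * n) / θ.den = K / θ.den - ε / θ.den * n := by ring
    linarith
  · rintro ⟨ε, hε, K, hK⟩
    refine ⟨θ.den * ε, by positivity, θ.den * K, fun n => ?_⟩
    have := mul_le_mul_of_nonneg_left (hK n) hd.le
    linarith

theorem winsFrom_shiftThreshold (θ : ℚ) (P : Player) (v : V) :
    (G.shiftThreshold θ).WinsFrom 0 P v ↔ G.WinsFrom θ P v := by
  have h : ∀ p, (G.shiftThreshold θ).WinsPlay 0 p P ↔ G.WinsPlay θ p P := by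
    intro p
    have := G.meanPayoff_shiftThreshold_neg θ p
    cases P <;>
      · simp only [WinsPlay, Rat.cast_zero, EReal.coe_zero, this]
        rfl
  simp only [WinsFrom, h]
  rfl

end MeanPayoffParityGame

/-- The opponent of a player. -/
def Player.opp : Player → Player
  | .con => .dis
  | .dis => .con

theorem Player.ne_iff {P Q : Player} : Q ≠ P ↔ Q = P.opp := by
  cases P <;> cases Q <;> simp [Player.opp]

theorem Player.opp_opp (P : Player) : P.opp.opp = P := by
  cases P <;> rfl

theorem Player.ne_opp_iff {P Q : Player} : Q ≠ P.opp ↔ Q = P := by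
  rw [Player.ne_iff, Player.opp_opp]

namespace MeanPayoffParityGame

variable {V : Type*} {G : MeanPayoffParityGame V}

theorem exists_abs_bound {V : Type*} [Finite V] (g : V → ℝ) : ∃ K, 0 ≤ K ∧ ∀ v, |g v| ≤ K := by
  have := Fintype.ofFinite V
  exact ⟨∑ v, |g v|, Finset.sum_nonneg fun _ _ => abs_nonneg _, fun v =>
    Finset.single_le_sum (f := fun v => |g v|) (fun _ _ => abs_nonneg _) (Finset.mem_univ v)⟩

theorem exists_nat_bound {V : Type*} [Finite V] (g : V → ℕ) : ∃ K, ∀ v, g v ≤ K := by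
  have := Fintype.ofFinite V
  exact ⟨∑ v, g v, fun v => Finset.single_le_sum (fun _ _ => Nat.zero_le _) (Finset.mem_univ v)⟩

/-! ### Traps -/

theorem IsTrap.trans {P : Player} {W X Y : Set V} (hX : G.IsTrap P W X) (hY : G.IsTrap P X Y) :
    G.IsTrap P W Y :=
  ⟨hY.1.trans hX.1, fun v hv => ⟨fun ho u hu he =>
    (hY.2 v hv).1 ho u ((hX.2 v (hY.1 hv)).1 ho u hu he) he, (hY.2 v hv).2⟩⟩

theorem IsTrap.mono {P : Player} {W W' X : Set V} (hX : G.IsTrap P W X) (hW : W' ⊆ W)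
    (hXW : X ⊆ W') : G.IsTrap P W' X :=
  ⟨hXW, fun v hv => ⟨fun ho u hu => (hX.2 v hv).1 ho u (hW hu), (hX.2 v hv).2⟩⟩

theorem IsTrap.isSubgame {P : Player} {W X : Set V} (hX : G.IsTrap P W X) (hW : G.IsSubgame W)
    (hne : X.Nonempty) : G.IsSubgame X := by
  refine ⟨hne, fun v hv => ?_⟩
  by_cases ho : G.owner v = P
  · obtain ⟨u, hu, he⟩ := hW.2 v (hX.1 hv)
    exact ⟨u, (hX.2 v hv).1 ho u hu he, he⟩
  · exact (hX.2 v hv).2 ho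

theorem isTrap_empty (P : Player) (W : Set V) : G.IsTrap P W ∅ :=
  ⟨Set.empty_subset _, fun _ hv => hv.elim⟩

theorem IsSubgame.isTrap_self {W : Set V} (hW : G.IsSubgame W) (P : Player) : G.IsTrap P W W :=
  ⟨subset_rfl, fun v hv => ⟨fun _ _ hu _ => hu, fun _ => hW.2 v hv⟩⟩

theorem IsPlay.shift {W : Set V} {p : ℕ → V} (hp : G.IsPlay W p) (N : ℕ) :
    G.IsPlay W fun n => p (n + N) := by
  intro n
  have := hp (n + N)
  rwa [show n + N + 1 = n + 1 + N by ring] at this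

/-! ### Attractors -/

variable (G) in
/-- The positional strategy `τ` decreases `rank` on `T` until `B` is reached. -/
structure Attracts (P : Player) (W T B : Set V) (τ : V → V) (rank : V → ℕ) : Prop where
  positional : G.IsPositional P W T τ
  decrease : ∀ v ∈ T, ∀ u ∈ W, G.Edge v u → (G.owner v = P → u = τ v) →
    u ∈ B ∨ (u ∈ T ∧ rank u < rank v)

namespace Attracts

variable {P : Player} {W W' T B : Set V} {τ : V → V} {rank : V → ℕ}

theorem mono (h : G.Attracts P W T B τ rank) (hW : W' ⊆ W) (hT : T ⊆ W') (hB : B ⊆ W') :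
    G.Attracts P W' T B τ rank where
  positional v hv ho := by
    obtain ⟨h1, h2⟩ := h.positional v hv ho
    refine ⟨?_, h2⟩
    rcases h.decrease v hv _ h1 h2 fun _ => rfl with h' | h'
    · exact hB h'
    · exact hT h'.1
  decrease v hv u hu := h.decrease v hv u (hW hu)

theorem isReachabilityStrategy (h : G.Attracts P W T B τ rank) :
    G.IsReachabilityStrategy P W T B τ := by
  refine ⟨h.positional, fun p hp h0 hf => ?_⟩
  induction hr : rank (p 0) using Nat.strong_induction_on generalizing p with
  | _ r ih =>
  rcases h.decrease _ h0 _ (hp 1).1 (hp 0).2 (hf 0 h0) with h' | ⟨h1, h2⟩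
  · exact ⟨1, h', fun m hm => by rwa [Nat.lt_one_iff.1 hm]⟩
  · obtain ⟨n, hn, hm⟩ := ih _ (hr ▸ h2) (fun n => p (n + 1)) (hp.shift 1) h1
      (fun n => hf (n + 1)) rfl
    refine ⟨n + 1, hn, fun m hmn => ?_⟩
    cases m with
    | zero => exact h0
    | succ m => exact hm m (by omega)

-- If the remainder is not a trap for `P`, some vertex in it either belongs to `P` and has an edge
-- into `T ∪ B`, or belongs to the opponent and has all its edges in `W` leading there. Such a
-- vertex joins `T` with a rank above all present ranks, and the remainder shrinks.
open Classical in
theorem exists_extension [Finite V] (hW : G.IsSubgame W) (h : G.Attracts P W T B τ rank)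
    (hT : T ⊆ W) (hd : Disjoint T B) :
    ∃ T τ rank, T ⊆ W ∧ Disjoint T B ∧ G.Attracts P W T B τ rank ∧
      G.IsTrap P W (W \ (T ∪ B)) := by
  induction hn : (W \ (T ∪ B)).ncard using Nat.strong_induction_on generalizing T τ rank with
  | _ n ih =>
  by_cases htrap : G.IsTrap P W (W \ (T ∪ B))
  · exact ⟨T, τ, rank, hT, hd, h, htrap⟩
  · obtain ⟨v, ⟨hvW, hv⟩, u₀, hu₀W, hu₀, hall⟩ : ∃ v ∈ W \ (T ∪ B), ∃ u₀ ∈ W, G.Edge v u₀ ∧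
        ∀ u ∈ W, G.Edge v u → (G.owner v = P → u = u₀) → u ∈ T ∪ B := by
      simp only [IsTrap, Set.sdiff_subset, true_and, not_forall] at htrap
      obtain ⟨v, hv, hv'⟩ := htrap
      refine ⟨v, hv, ?_⟩
      by_cases ho : G.owner v = P
      · simp only [ho, true_implies, ne_eq, not_true_eq_false, false_implies, and_true,
          not_forall] at hv'
        obtain ⟨u, hu, he, hu'⟩ := hv'
        refine ⟨u, hu, he, fun x _ _ hx => ?_⟩
        rw [hx ho]
        by_contra hc
        exact hu' ⟨hu, hc⟩
      · obtain ⟨u, hu, he⟩ := hW.2 v hv.1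
        refine ⟨u, hu, he, fun x hx hex _ => ?_⟩
        by_contra hc
        exact hv' ⟨fun h' => absurd h' ho, fun _ => ⟨x, ⟨hx, hc⟩, hex⟩⟩
    obtain ⟨hvT, hvB⟩ : v ∉ T ∧ v ∉ B := by simpa [not_or] using hv
    obtain ⟨K, hK⟩ := exists_nat_bound rank
    refine ih _ ?_ (T := insert v T) (τ := Function.update τ v u₀)
      (rank := Function.update rank v (K + 1)) ⟨?_, ?_⟩ (Set.insert_subset hvW hT)
      (Set.disjoint_insert_left.2 ⟨hvB, hd⟩) rfl
    · rw [← hn]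
      refine Set.ncard_lt_ncard ⟨?_, ?_⟩ (Set.toFinite _)
      · exact Set.sdiff_subset_sdiff_right (Set.union_subset_union_left _ (Set.subset_insert _ _))
      · intro hsub
        exact (hsub ⟨hvW, hv⟩).2 (Or.inl (Set.mem_insert _ _))
    · intro x hx ho
      by_cases hxv : x = v
      · subst hxv; simpa using ⟨hu₀W, hu₀⟩
      · simpa [hxv] using h.positional x (hx.resolve_left hxv) ho
    · intro x hx u hu he hf
      by_cases hxv : x = v
      · subst hxv
        simp only [Function.update_self] at hf ⊢
        rcases hall u hu he hf with h' | h'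
        · have : u ≠ x := fun e => hvT (e ▸ h')
          exact Or.inr ⟨Or.inr h', by simpa [this] using Nat.lt_succ_of_le (hK u)⟩
        · exact Or.inl h'
      · have hxT := hx.resolve_left hxv
        simp only [ne_eq, hxv, not_false_eq_true, Function.update_of_ne] at hf ⊢
        rcases h.decrease x hxT u hu he hf with h' | ⟨h1, h2⟩
        · exact Or.inl h'
        · have : u ≠ v := fun e => hvT (e ▸ h1)
          exact Or.inr ⟨Or.inr h1, by simpa [this] using h2⟩

end Attracts

theorem IsSubgame.exists_attractor [Finite V] {W : Set V} (hW : G.IsSubgame W) (P : Player)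
    (B : Set V) (hB : B ⊆ W) : ∃ U T τ rank, IsPartition W U T B ∧
      G.Attracts P W T B τ rank ∧ G.IsTrap P W U := by
  obtain ⟨T, τ, rank, hT, hd, ha, htrap⟩ := Attracts.exists_extension (P := P) (T := ∅) (B := B)
    (τ := id) (rank := fun _ => 0) hW ⟨fun v hv => hv.elim, fun v hv => hv.elim⟩
    (Set.empty_subset _) (Set.empty_disjoint _)
  refine ⟨W \ (T ∪ B), T, τ, rank, ⟨?_, ?_, ?_, hd⟩, ha, htrap⟩
  · rw [Set.union_assoc, Set.sdiff_union_of_subset (Set.union_subset hT hB)]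
  · exact Set.disjoint_left.2 fun x hx hx' => hx.2 (Or.inl hx')
  · exact Set.disjoint_left.2 fun x hx hx' => hx.2 (Or.inr hx')

/-! ### Strategies with memory -/

/-- A strategy with memory: a move depending on the memory state and the current vertex, and an
update of the memory. -/
structure MemoryStrategy (V : Type*) where
  Memory : Type
  start : Memory
  move : Memory → V → V
  update : Memory → V → Memory

variable (G) in
/-- `p` is a play in `W` that follows `s`, with the sequence `m` of memory states. -/
structure IsRun (P : Player) (W : Set V) (s : MemoryStrategy V) (p : ℕ → V) (m : ℕ → s.Memory) :
    Prop where
  isPlay : G.IsPlay W p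
  update : ∀ n, m (n + 1) = s.update (m n) (p n)
  follows : ∀ n, G.owner (p n) = P → p (n + 1) = s.move (m n) (p n)

variable (G) in
/-- `s` stays in `W`, achieves the objective on every run from every memory state, and `Φ` is a
potential that bounds the sums of the weights on its runs. -/
structure IsWinningWith (P : Player) (w : V → V → ℝ) (W : Set V) (s : MemoryStrategy V)
    (Φ : s.Memory → V → ℝ) (K : ℝ) : Prop where
  move : ∀ m, ∀ v ∈ W, G.owner v = P → s.move m v ∈ W ∧ G.Edge v (s.move m v)
  nonneg : ∀ m, ∀ v ∈ W, 0 ≤ Φ m v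
  le : ∀ m, ∀ v ∈ W, Φ m v ≤ K
  potential : ∀ m, ∀ v ∈ W, ∀ u ∈ W, G.Edge v u → (G.owner v = P → u = s.move m v) →
    w v u + Φ (s.update m v) u ≤ Φ m v
  objective : ∀ p m, G.IsRun P W s p m → G.Objective P p

variable (G) in
/-- The weights controlled by a winning strategy: costs increased by `ε` for Con; no requirement
for Dis. -/
def weight : Player → ℝ → V → V → ℝ
  | .con, ε, v, u => G.cost v u + ε
  | .dis, _, _, _ => -1

variable (G) in
/-- The player has a strategy with memory that wins from every vertex of `W` in the game on `W`,
with a margin `ε` for Con. -/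
def Wins (P : Player) (W : Set V) : Prop :=
  ∃ ε : ℝ, 0 < ε ∧ ∃ s Φ K, G.IsWinningWith P (G.weight P ε) W s Φ K

theorem weight_mono (P : Player) {ε ε' : ℝ} (h : ε ≤ ε') (v u : V) :
    G.weight P ε v u ≤ G.weight P ε' v u := by
  cases P with
  | con => simpa [weight] using h
  | dis => simp [weight]

theorem exists_weight_le [Finite V] (P : Player) (ε : ℝ) :
    ∃ C, 0 ≤ C ∧ ∀ v u, G.weight P ε v u ≤ C := by
  obtain ⟨C, h0, hC⟩ := exists_abs_bound fun x : V × V => G.weight P ε x.1 x.2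
  exact ⟨C, h0, fun v u => (le_abs_self _).trans (hC (v, u))⟩

theorem IsWinningWith.mono {P : Player} {w w' : V → V → ℝ} {W : Set V} {s : MemoryStrategy V}
    {Φ : s.Memory → V → ℝ} {K : ℝ} (h : G.IsWinningWith P w W s Φ K)
    (hw : ∀ v u, w' v u ≤ w v u) : G.IsWinningWith P w' W s Φ K :=
  { h with
    potential := fun m v hv u hu he hf =>
      (add_le_add_left (hw v u) _).trans (h.potential m v hv u hu he hf) }

theorem wins_empty (P : Player) : G.Wins P ∅ :=
  ⟨1, one_pos, ⟨Unit, (), fun _ v => v, fun _ _ => ()⟩, fun _ _ => 0, 0,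
    fun _ _ hv => hv.elim, fun _ _ hv => hv.elim, fun _ _ hv => hv.elim, fun _ _ hv => hv.elim,
    fun _ _ h => (h.isPlay 0).1.elim⟩

theorem IsWinningWith.winsPlay {P : Player} {ε : ℝ} {W : Set V} {s : MemoryStrategy V}
    {Φ : s.Memory → V → ℝ} {K : ℝ} (h : G.IsWinningWith P (G.weight P ε) W s Φ K) (hε : 0 < ε)
    {p : ℕ → V} {m : ℕ → s.Memory} (hp : G.IsRun P W s p m) : G.WinsPlay 0 p P := by
  have hobj := h.objective p m hp
  cases P with
  | con =>
    refine ⟨hobj, ?_⟩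
    simp only [Rat.cast_zero, EReal.coe_zero]
    refine meanPayoff_neg_of_potential (Φ := fun n => Φ (m n) (p n)) (K := 0) hε (fun n => ?_)
      fun n => ?_
    · simpa using h.nonneg (m n) _ (hp.isPlay n).1
    · have := h.potential (m n) _ (hp.isPlay n).1 _ (hp.isPlay (n + 1)).1 (hp.isPlay n).2
        (hp.follows n)
      rwa [← hp.update n] at this
  | dis => simpa [WinsPlay, Objective] using hobj

theorem not_winsPlay_opp {θ : ℚ} {p : ℕ → V} {P : Player} (h : G.WinsPlay θ p P) :
    ¬ G.WinsPlay θ p P.opp := by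
  cases P with
  | con => exact fun h' => h' h
  | dis => exact h

/-- If the two strategies are played against each other from a vertex of `X`, the play stays in `X`
and is won by both players. -/
theorem Wins.eq_empty_of_isTrap {P : Player} {W X : Set V} (hW : G.Wins P W)
    (hX : G.Wins P.opp X) (htrap : G.IsTrap P W X) : X = ∅ := by
  classical
  by_contra hne
  obtain ⟨x, hx⟩ := Set.nonempty_iff_ne_empty.2 hne
  obtain ⟨ε, hε, s, Φ, K, hs⟩ := hW
  obtain ⟨ε', hε', s', Φ', K', hs'⟩ := hX
  let step : V × s.Memory × s'.Memory → V × s.Memory × s'.Memory := fun a =>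
    (if G.owner a.1 = P then s.move a.2.1 a.1 else s'.move a.2.2 a.1,
      s.update a.2.1 a.1, s'.update a.2.2 a.1)
  let a : ℕ → V × s.Memory × s'.Memory := fun n => step^[n] (x, s.start, s'.start)
  have ha : ∀ n, a (n + 1) = step (a n) := fun n => Function.iterate_succ_apply' _ _ _
  have hstep : ∀ b, b.1 ∈ X → (step b).1 ∈ X ∧ G.Edge b.1 (step b).1 := by
    intro b hb
    by_cases ho : G.owner b.1 = P
    · simp only [step, ho, if_true]
      obtain ⟨h1, h2⟩ := hs.move b.2.1 _ (htrap.1 hb) ho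
      exact ⟨(htrap.2 _ hb).1 ho _ h1 h2, h2⟩
    · simp only [step, ho, if_false]
      exact hs'.move b.2.2 _ hb (Player.ne_iff.1 ho)
  have haX : ∀ n, (a n).1 ∈ X := by
    intro n
    induction n with
    | zero => exact hx
    | succ n ih => rw [ha]; exact (hstep _ ih).1
  have hplay : G.IsPlay X fun n => (a n).1 := by
    intro n
    refine ⟨haX n, ?_⟩
    simp only [ha]
    exact (hstep _ (haX n)).2
  have h1 : G.IsRun P W s (fun n => (a n).1) fun n => (a n).2.1 :=
    ⟨fun n => ⟨htrap.1 (hplay n).1, (hplay n).2⟩, fun n => by simp only [ha, step],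
      fun n ho => by simp only [ha, step, if_pos ho]⟩
  have h2 : G.IsRun P.opp X s' (fun n => (a n).1) fun n => (a n).2.2 :=
    ⟨hplay, fun n => by simp only [ha, step],
      fun n ho => by simp only [ha, step, if_neg (Player.ne_iff.2 ho)]⟩
  exact not_winsPlay_opp (hs.winsPlay hε h1) (hs'.winsPlay hε' h2)

theorem IsPartition.mem_iff {W X Y Z : Set V} (h : IsPartition W X Y Z) (v : V) :
    v ∈ W ↔ v ∈ X ∨ v ∈ Y ∨ v ∈ Z := by
  rw [← h.1]
  simp [or_assoc]

theorem IsRun.shift {P : Player} {W : Set V} {s : MemoryStrategy V} {p : ℕ → V}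
    {m : ℕ → s.Memory} (h : G.IsRun P W s p m) (N : ℕ) :
    G.IsRun P W s (fun n => p (n + N)) fun n => m (n + N) where
  isPlay := h.isPlay.shift N
  update n := by
    have := h.update (n + N)
    rwa [show n + N + 1 = n + 1 + N by ring] at this
  follows n ho := by
    have := h.follows (n + N) ho
    rwa [show n + N + 1 = n + 1 + N by ring] at this

/-! ### Composition of winning strategies -/

open Classical in
/-- If `R` is a trap for the opponent, the player wins on `R` and on `U`, and reaches `R` from all
other vertices, then the player wins everywhere. -/
theorem Wins.of_trap [Finite V] {P : Player} {W U T R : Set V} {τ : V → V} {rank : V → ℕ}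
    (hpart : IsPartition W U T R) (htrap : G.IsTrap P.opp W R)
    (hT : G.Attracts P W T R τ rank) (hR : G.Wins P R) (hU : G.Wins P U) : G.Wins P W := by
  obtain ⟨ε₁, hε₁, s₁, Φ₁, K₁, h₁⟩ := hR
  obtain ⟨ε₂, hε₂, s₂, Φ₂, K₂, h₂⟩ := hU
  obtain ⟨hunion, hUT, hUR, hTR⟩ := id hpart
  set ε := min ε₁ ε₂ with hε
  replace h₁ := h₁.mono (w' := G.weight P ε) fun v u => weight_mono P (min_le_left _ _) v u
  replace h₂ := h₂.mono (w' := G.weight P ε) fun v u => weight_mono P (min_le_right _ _) v u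
  obtain ⟨C, hC, hw⟩ := G.exists_weight_le P ε
  obtain ⟨N, hN⟩ := exists_nat_bound rank
  have hCN : ∀ v, C * (rank v : ℝ) ≤ C * N := fun v =>
    mul_le_mul_of_nonneg_left (by exact_mod_cast hN v) hC
  have hCr : ∀ v, 0 ≤ C * (rank v : ℝ) := fun v => by positivity
  have nR : ∀ v ∈ U, v ∉ R := fun v hv hv' => Set.disjoint_left.1 hUR hv hv'
  have nT : ∀ v ∈ U, v ∉ T := fun v hv hv' => Set.disjoint_left.1 hUT hv hv'
  have nRT : ∀ v ∈ T, v ∉ R := fun v hv hv' => Set.disjoint_left.1 hTR hv hv'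
  -- Both memories are updated all the time. The state in which a component is entered is
  -- irrelevant, since winning is required from every memory state.
  let s : MemoryStrategy V :=
    { Memory := s₁.Memory × s₂.Memory
      start := (s₁.start, s₂.start)
      move := fun m v => if v ∈ R then s₁.move m.1 v else if v ∈ T then τ v else s₂.move m.2 v
      update := fun m v => (s₁.update m.1 v, s₂.update m.2 v) }
  -- Plays only move down from `U` to `T` to `R`. The levels are stacked so that each passage, and
  -- each step of the attractor, pays for one edge of weight at most `C`.
  let Φ : s.Memory → V → ℝ := fun m v =>
    if v ∈ R then Φ₁ m.1 v else if v ∈ T then max K₁ 0 + C * (rank v + 1)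
    else max K₁ 0 + C * (N + 2) + Φ₂ m.2 v
  have moveR : ∀ m, ∀ v ∈ R, s.move m v = s₁.move m.1 v := fun m v hv => by simp [s, hv]
  have moveT : ∀ m, ∀ v ∈ T, s.move m v = τ v := fun m v hv => by simp [s, hv, nRT v hv]
  have moveU : ∀ m, ∀ v ∈ U, s.move m v = s₂.move m.2 v := fun m v hv => by
    simp [s, nR v hv, nT v hv]
  have ΦR : ∀ m, ∀ v ∈ R, Φ m v = Φ₁ m.1 v := fun m v hv => by simp [Φ, hv]
  have ΦT : ∀ m, ∀ v ∈ T, Φ m v = max K₁ 0 + C * (rank v + 1) := fun m v hv => by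
    simp [Φ, hv, nRT v hv]
  have ΦU : ∀ m, ∀ v ∈ U, Φ m v = max K₁ 0 + C * (N + 2) + Φ₂ m.2 v := fun m v hv => by
    simp [Φ, nR v hv, nT v hv]
  have hK : 0 ≤ max K₁ 0 := le_max_right _ _
  have hK' : K₁ ≤ max K₁ 0 := le_max_left _ _
  have hK₂ : K₂ ≤ max K₂ 0 := le_max_left _ _
  have hK₂' : 0 ≤ max K₂ 0 := le_max_right _ _
  have hCN0 : 0 ≤ C * (N : ℝ) := by positivity
  have stayR : ∀ m, ∀ v ∈ R, ∀ u ∈ W, G.Edge v u → (G.owner v = P → u = s.move m v) → u ∈ R := by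
    intro m v hv u hu he hf
    by_cases ho : G.owner v = P
    · rw [hf ho, moveR m v hv]
      exact (h₁.move m.1 v hv ho).1
    · exact (htrap.2 v hv).1 (Player.ne_iff.1 ho) u hu he
  refine ⟨ε, lt_min hε₁ hε₂, s, Φ, max K₁ 0 + C * (N + 2) + max K₂ 0, ?_, ?_, ?_, ?_, ?_⟩
  · intro m v hv ho
    rcases (hpart.mem_iff v).1 hv with hv | hv | hv
    · rw [moveU m v hv]
      obtain ⟨h, he⟩ := h₂.move m.2 v hv ho
      exact ⟨(hpart.mem_iff _).2 (Or.inl h), he⟩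
    · rw [moveT m v hv]
      exact hT.positional v hv ho
    · rw [moveR m v hv]
      obtain ⟨h, he⟩ := h₁.move m.1 v hv ho
      exact ⟨(hpart.mem_iff _).2 (Or.inr (Or.inr h)), he⟩
  · intro m v hv
    rcases (hpart.mem_iff v).1 hv with hv | hv | hv
    · have := h₂.nonneg m.2 v hv
      rw [ΦU m v hv]
      linarith
    · have := hCr v
      rw [ΦT m v hv]
      linarith
    · rw [ΦR m v hv]
      exact h₁.nonneg m.1 v hv
  · intro m v hv
    rcases (hpart.mem_iff v).1 hv with hv | hv | hv
    · have := h₂.le m.2 v hv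
      rw [ΦU m v hv]
      linarith
    · have := hCN v
      rw [ΦT m v hv]
      linarith
    · have := h₁.le m.1 v hv
      rw [ΦR m v hv]
      linarith
  · intro m v hv u hu he hf
    have hwvu := hw v u
    rcases (hpart.mem_iff v).1 hv with hv | hv | hv
    · have h0 := h₂.nonneg m.2 v hv
      rw [ΦU m v hv]
      rcases (hpart.mem_iff u).1 hu with hu | hu | hu
      · rw [ΦU _ u hu]
        have := h₂.potential m.2 v hv u hu he fun ho => by rw [hf ho, moveU m v hv]
        linarith
      · rw [ΦT _ u hu]
        have := hCN u
        linarith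
      · rw [ΦR _ u hu]
        have := h₁.le (s.update m v).1 u hu
        linarith
    · rw [ΦT m v hv]
      rcases hT.decrease v hv u hu he fun ho => by rw [hf ho, moveT m v hv] with h | ⟨h, hr⟩
      · rw [ΦR _ u h]
        have := h₁.le (s.update m v).1 u h
        have := hCr v
        linarith
      · rw [ΦT _ u h]
        have : C * ((rank u : ℝ) + 1) ≤ C * rank v :=
          mul_le_mul_of_nonneg_left (by exact_mod_cast hr) hC
        linarith
    · have huR := stayR m v hv u hu he hf
      rw [ΦR m v hv, ΦR _ u huR]
      exact h₁.potential m.1 v hv u huR he fun ho => by rw [hf ho, moveR m v hv]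
  · intro p m hp
    have run_R : ∀ n, p n ∈ R → G.Objective P p := by
      intro n hn
      have hstay : ∀ k, p (k + n) ∈ R := by
        intro k
        induction k with
        | zero => simpa using hn
        | succ k ih =>
          have := stayR (m (k + n)) _ ih _ (hp.isPlay (k + n + 1)).1 (hp.isPlay (k + n)).2
            (hp.follows (k + n))
          rwa [show k + n + 1 = k + 1 + n by ring] at this
      refine .of_shift n (h₁.objective _ (fun k => (m (k + n)).1) ⟨fun k =>
        ⟨hstay k, ((hp.shift n).isPlay k).2⟩, fun k => ?_, fun k ho => ?_⟩)
      · rw [(hp.shift n).update k]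
      · rw [(hp.shift n).follows k ho, moveR _ _ (hstay k)]
    have run_T : ∀ n, p n ∈ T → G.Objective P p := by
      intro n hn
      obtain ⟨k, hk, -⟩ := hT.isReachabilityStrategy.2 (fun k => p (k + n)) (hp.shift n).isPlay
        (by simpa using hn) fun k hk ho =>
          ((hp.shift n).follows k ho).trans (moveT _ _ hk)
      exact run_R _ hk
    -- A play that ever leaves `U` ends up in `R` and remains there; the objective does not depend
    -- on the prefix.
    by_cases hU : ∀ n, p n ∈ U
    · refine h₂.objective _ (fun k => (m k).2) ⟨fun k => ⟨hU k, (hp.isPlay k).2⟩, fun k => ?_,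
        fun k ho => ?_⟩
      · rw [hp.update k]
      · rw [hp.follows k ho, moveU _ _ (hU k)]
    · push Not at hU
      obtain ⟨n, hn⟩ := hU
      rcases (hpart.mem_iff _).1 (hp.isPlay n).1 with h | h | h
      · exact absurd h hn
      · exact run_T n h
      · exact run_R n h

variable (G) in
/-- The positional strategy `l` of the player has a potential on `W` for the weights of the
player, with a margin `δ` in every step. -/
def HasPotential (P : Player) (W : Set V) (l : V → V) : Prop :=
  G.IsPositional P W W l ∧ ∃ (δ : ℝ) (g : V → ℝ), 0 < δ ∧ ∀ v ∈ W, ∀ u ∈ W, G.Edge v u →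
    (G.owner v = P → u = l v) → G.weight P δ v u + δ + g u ≤ g v

open Classical in
/-- If the player wins on `R`, reaches the biggest priority, which is good for the player, from all
other vertices, and has a positional strategy on `W` with a potential, then the player wins
everywhere. -/
theorem Wins.of_top [Finite V] {P : Player} {W R T B : Set V} {τ l : V → V} {rank : V → ℕ} {b : ℕ}
    (hle : ∀ v ∈ W, G.priority v ≤ b) (hP : GoodParity P b) (hpart : IsPartition W R T B)
    (hB : ∀ v ∈ B, G.priority v = b) (hT : G.Attracts P W T B τ rank) (hR : G.Wins P R)
    (hl : G.HasPotential P W l) : G.Wins P W := by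
  obtain ⟨ε₁, hε₁, s₁, Φ₁, K₁, h₁⟩ := hR
  obtain ⟨hlpos, δ, g, hδ, hg⟩ := hl
  obtain ⟨hunion, hRT, hRB, hTB⟩ := id hpart
  set ε := min ε₁ δ with hε
  replace h₁ := h₁.mono (w' := G.weight P ε) fun v u => weight_mono P (min_le_left _ _) v u
  replace hg : ∀ v ∈ W, ∀ u ∈ W, G.Edge v u → (G.owner v = P → u = l v) →
      G.weight P ε v u + δ + g u ≤ g v := fun v hv u hu he hf =>
    le_trans (by linarith [weight_mono (G := G) P (min_le_right ε₁ δ) v u]) (hg v hv u hu he hf)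
  obtain ⟨C, hC, hw⟩ := G.exists_weight_le P ε
  obtain ⟨N, hN⟩ := exists_nat_bound rank
  obtain ⟨K₂, hK₂, hgK⟩ := exists_abs_bound g
  have hgle : ∀ v, g v ≤ K₂ := fun v => (abs_le.1 (hgK v)).2
  have hgge : ∀ v, -K₂ ≤ g v := fun v => (abs_le.1 (hgK v)).1
  have hCN : ∀ v, C * (rank v : ℝ) ≤ C * N := fun v =>
    mul_le_mul_of_nonneg_left (by exact_mod_cast hN v) hC
  have hCr : ∀ v, 0 ≤ C * (rank v : ℝ) := fun v => by positivity
  have hCN0 : 0 ≤ C * (N : ℝ) := by positivity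
  have nR : ∀ v ∈ R, v ∉ B := fun v hv hv' => Set.disjoint_left.1 hRB hv hv'
  have nT : ∀ v ∈ T, v ∉ B := fun v hv hv' => Set.disjoint_left.1 hTB hv hv'
  have nRT : ∀ v ∈ R, v ∉ T := fun v hv hv' => Set.disjoint_left.1 hRT hv hv'
  -- `A` bounds the potential outside the mean-payoff phase, which lasts `L + 1` steps
  set A : ℝ := C * (N + 2) + max K₁ 0 with hA
  have hK : 0 ≤ max K₁ 0 := le_max_right _ _
  have hK' : K₁ ≤ max K₁ 0 := le_max_left _ _
  -- Each step with `l` gains `δ`. The phase is long enough to recover the bound `A`, which is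
  -- needed when the other strategies resume, and the oscillation `2 * K₂` of `g`.
  obtain ⟨L, hL⟩ : ∃ L : ℕ, A + 2 * K₂ ≤ δ * (L + 1 : ℕ) := by
    obtain ⟨L, hL⟩ := exists_nat_gt ((A + 2 * K₂) / δ)
    rw [div_lt_iff₀ hδ] at hL
    refine ⟨L, ?_⟩
    push_cast
    linarith
  -- The second component counts down the remaining steps of the mean-payoff phase. A visit to `B`
  -- starts the phase only when the counter is zero; visits during the countdown do not restart it.
  let s : MemoryStrategy V :=
    { Memory := s₁.Memory × Fin (L + 2)
      start := (s₁.start, 0)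
      move := fun m v => if m.2.val = 0 then
          if v ∈ B then l v else if v ∈ T then τ v else s₁.move m.1 v
        else l v
      update := fun m v => (s₁.update m.1 v,
        if m.2.val = 0 then if v ∈ B then Fin.last _ else 0 else ⟨m.2.val - 1, by omega⟩) }
  let Φ₀ : s₁.Memory → V → ℝ := fun m v =>
    if v ∈ B then 0 else if v ∈ T then C * (rank v + 1) else C * (N + 2) + Φ₁ m v
  -- The summand `δ * (L + 1)` only keeps the potential non-negative during the countdown.
  let Φ : s.Memory → V → ℝ := fun m v => δ * (L + 1 : ℕ) +
    if m.2.val = 0 then Φ₀ m.1 v else A + K₂ + g v - δ * m.2.val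
  have moveL : ∀ m v, (m.2.val = 0 → v ∈ B) → s.move m v = l v := fun m v h => by
    by_cases h0 : m.2.val = 0
    · simp [s, h0, h h0]
    · simp [s, h0]
  have moveT : ∀ m, m.2.val = 0 → ∀ v ∈ T, s.move m v = τ v := fun m h v hv => by
    simp [s, h, hv, nT v hv]
  have moveR : ∀ m, m.2.val = 0 → ∀ v ∈ R, s.move m v = s₁.move m.1 v := fun m h v hv => by
    simp [s, h, nR v hv, nRT v hv]
  have updZero : ∀ m, m.2.val = 0 → ∀ v, v ∉ B → (s.update m v).2.val = 0 := fun m h v hv => by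
    simp [s, h, hv]
  have updB : ∀ m, m.2.val = 0 → ∀ v ∈ B, (s.update m v).2.val = L + 1 := fun m h v hv => by
    simp [s, h, hv]
  have updPos : ∀ m, m.2.val ≠ 0 → ∀ v, (s.update m v).2.val = m.2.val - 1 := fun m h v => by
    simp [s, h]
  have ΦB : ∀ m, ∀ v ∈ B, Φ₀ m v = 0 := fun m v hv => by simp [Φ₀, hv]
  have ΦT : ∀ m, ∀ v ∈ T, Φ₀ m v = C * (rank v + 1) := fun m v hv => by simp [Φ₀, hv, nT v hv]
  have ΦR : ∀ m, ∀ v ∈ R, Φ₀ m v = C * (N + 2) + Φ₁ m v := fun m v hv => by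
    simp [Φ₀, nR v hv, nRT v hv]
  have Φ₀_nonneg : ∀ m, ∀ v ∈ W, 0 ≤ Φ₀ m v := by
    intro m v hv
    rcases (hpart.mem_iff v).1 hv with hv | hv | hv
    · have := h₁.nonneg m v hv
      rw [ΦR m v hv]
      linarith
    · have := hCr v
      rw [ΦT m v hv]
      linarith
    · rw [ΦB m v hv]
  have Φ₀_le : ∀ m, ∀ v ∈ W, Φ₀ m v ≤ A := by
    intro m v hv
    rcases (hpart.mem_iff v).1 hv with hv | hv | hv
    · have := h₁.le m v hv
      rw [ΦR m v hv]
      linarith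
    · have := hCN v
      rw [ΦT m v hv]
      linarith
    · rw [ΦB m v hv]
      linarith
  have hfin : ∀ k : Fin (L + 2), δ * (k.val : ℝ) ≤ δ * (L + 1 : ℕ) := fun k =>
    mul_le_mul_of_nonneg_left (by exact_mod_cast (by omega : k.val ≤ L + 1)) hδ.le
  have hδL : 0 ≤ δ * ((L + 1 : ℕ) : ℝ) := by positivity
  refine ⟨ε, lt_min hε₁ hδ, s, Φ, δ * (L + 1 : ℕ) + A + 2 * K₂, ?_, ?_, ?_, ?_, ?_⟩
  · intro m v hv ho
    by_cases h0 : m.2.val = 0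
    · rcases (hpart.mem_iff v).1 hv with hv' | hv' | hv'
      · rw [moveR m h0 v hv']
        obtain ⟨h, he⟩ := h₁.move m.1 v hv' ho
        exact ⟨(hpart.mem_iff _).2 (Or.inl h), he⟩
      · rw [moveT m h0 v hv']
        exact hT.positional v hv' ho
      · rw [moveL m v fun _ => hv']
        exact hlpos v hv ho
    · rw [moveL m v fun h => absurd h h0]
      exact hlpos v hv ho
  · intro m v hv
    simp only [Φ]
    split_ifs with h0
    · have := Φ₀_nonneg m.1 v hv
      linarith
    · have := hfin m.2
      have := hgge v
      linarith
  · intro m v hv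
    simp only [Φ]
    split_ifs with h0
    · have := Φ₀_le m.1 v hv
      linarith
    · have : 0 ≤ δ * (m.2.val : ℝ) := by positivity
      have := hgle v
      linarith
  · intro m v hv u hu he hf
    have hwvu := hw v u
    by_cases h0 : m.2.val = 0
    · by_cases hvB : v ∈ B
      · have h1 := updB m h0 v hvB
        have h2 := hg v hv u hu he fun ho => by rw [hf ho, moveL m v fun _ => hvB]
        have := hgle v
        simp only [Φ, h1, h0, if_true, ΦB _ v hvB, if_neg (Nat.succ_ne_zero L)]
        linarith
      · have h1 := updZero m h0 v hvB
        have h2 : ∀ x, Φ x u = δ * (L + 1 : ℕ) +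
          if x.2.val = 0 then Φ₀ x.1 u else A + K₂ + g u - δ * x.2.val := fun _ => rfl
        rw [h2, if_pos h1]
        simp only [Φ, if_pos h0]
        suffices G.weight P ε v u + Φ₀ (s.update m v).1 u ≤ Φ₀ m.1 v by linarith
        rcases (hpart.mem_iff v).1 hv with hv' | hv' | hv'
        · have h3 := h₁.nonneg m.1 v hv'
          rw [ΦR _ v hv']
          rcases (hpart.mem_iff u).1 hu with hu' | hu' | hu'
          · rw [ΦR _ u hu']
            have := h₁.potential m.1 v hv' u hu' he fun ho => by rw [hf ho, moveR m h0 v hv']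
            linarith
          · rw [ΦT _ u hu']
            have := hCN u
            linarith
          · rw [ΦB _ u hu']
            linarith
        · rw [ΦT _ v hv']
          rcases hT.decrease v hv' u hu he fun ho => by rw [hf ho, moveT m h0 v hv'] with
            h | ⟨h, hr⟩
          · rw [ΦB _ u h]
            have := hCr v
            linarith
          · rw [ΦT _ u h]
            have : C * ((rank u : ℝ) + 1) ≤ C * rank v :=
              mul_le_mul_of_nonneg_left (by exact_mod_cast hr) hC
            linarith
        · exact absurd hv' hvB
    · have h1 := updPos m h0 v
      have h2 := hg v hv u hu he fun ho => by rw [hf ho, moveL m v fun h => absurd h h0]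
      have h3 : Φ (s.update m v) u ≤ δ * (L + 1 : ℕ) + (A + K₂ + g u - δ * (m.2.val - 1)) := by
        simp only [Φ, h1]
        split_ifs with h4
        · have : m.2.val = 1 := by omega
          have := Φ₀_le (s.update m v).1 u hu
          have := hgge u
          simp only [‹m.2.val = 1›]
          push_cast
          linarith
        · rw [Nat.cast_sub (by omega)]
          push_cast
          linarith
      simp only [Φ, if_neg h0] at h3 ⊢
      linarith
  · intro p m hp
    by_cases hfreq : ∃ᶠ n in Filter.atTop, p n ∈ B
    · exact .of_frequently_top hP (fun n => hle _ (hp.isPlay n).1) (hfreq.mono fun n => hB _)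
    -- After the last visit to `B` the counter runs out. From then on `T` is impossible, since its
    -- strategy would lead back to `B`, so the play stays in `R` and follows `s₁`.
    · obtain ⟨M, hM⟩ := Filter.eventually_atTop.1 (Filter.not_frequently.1 hfreq)
      have hcount : ∀ n, (m (n + M)).2.val ≤ L + 1 - n := by
        intro n
        induction n with
        | zero => have := (m (0 + M)).2.isLt; omega
        | succ n ih =>
          have hu := hp.update (n + M)
          rw [show n + M + 1 = n + 1 + M by ring] at hu
          rw [hu]
          by_cases h0 : (m (n + M)).2.val = 0
          · rw [updZero _ h0 _ (hM _ (by omega))]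
            omega
          · rw [updPos _ h0]
            omega
      set M' := L + 1 + M with hM'
      have hzero : ∀ n, (m (n + M')).2.val = 0 := by
        intro n
        have := hcount (n + (L + 1))
        rw [show n + (L + 1) + M = n + M' by omega] at this
        omega
      have hnT : ∀ n, p (n + M') ∉ T := by
        intro n hn
        have hs := hp.shift (n + M')
        obtain ⟨k, hk, -⟩ := hT.isReachabilityStrategy.2 _ hs.isPlay (by simpa using hn)
          fun k hk ho => by
            have hz : (m (k + (n + M'))).2.val = 0 := by
              rw [← add_assoc]; exact hzero _
            rw [hs.follows k ho, moveT _ hz _ hk]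
        exact hM _ (by omega) hk
      have hRall : ∀ n, p (n + M') ∈ R := by
        intro n
        rcases (hpart.mem_iff _).1 (hp.isPlay (n + M')).1 with h | h | h
        · exact h
        · exact absurd h (hnT n)
        · exact absurd h (hM _ (by omega))
      have hs := hp.shift M'
      refine .of_shift M' (h₁.objective _ (fun k => (m (k + M')).1) ⟨fun k =>
        ⟨hRall k, (hs.isPlay k).2⟩, fun k => ?_, fun k ho => ?_⟩)
      · rw [hs.update k]
      · rw [hs.follows k ho, moveR _ (hzero k) _ (hRall k)]

/-! ### Building decompositions -/

theorem DisDecomposition.isSubgameWithTop {b : ℕ} {W : Set V} (h : G.DisDecomposition b W) :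
    G.IsSubgameWithTop b W := by
  cases h <;> assumption

theorem ConDecomposition.isSubgameWithTop {b : ℕ} {W : Set V} (h : G.ConDecomposition b W) :
    G.IsSubgameWithTop b W := by
  cases h <;> assumption

theorem IsSubgameWithTop.le {b : ℕ} {W : Set V} (h : G.IsSubgameWithTop b W) {v : V} (hv : v ∈ W) :
    G.priority v ≤ b :=
  h.2.2 ⟨v, hv, rfl⟩

theorem IsSubgameWithTop.pos {b : ℕ} {W : Set V} (h : G.IsSubgameWithTop b W) : 0 < b := by
  obtain ⟨v, -, rfl⟩ := h.2.1
  exact G.priority_pos v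

theorem IsSubgameWithTop.mono {b b' : ℕ} {W W' : Set V} (h : G.IsSubgameWithTop b W)
    (h' : G.IsSubgameWithTop b' W') (hW : W' ⊆ W) : b' ≤ b := by
  obtain ⟨v, hv, rfl⟩ := h'.2.1
  exact h.le (hW hv)

theorem IsSubgameWithTop.lt {b b' : ℕ} {W' : Set V} (h' : G.IsSubgameWithTop b' W')
    (hlt : ∀ v ∈ W', G.priority v < b) : b' < b := by
  obtain ⟨v, hv, rfl⟩ := h'.2.1
  exact hlt v hv

variable (G) in
/-- The part `R` may serve as the recurrent part of a decomposition for the player when the biggest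
priority `b` is bad for the player. -/
def IsRecurrent (P : Player) (b : ℕ) (R : Set V) : Prop :=
  (G.HasStrategyDecomposition R P ∧ ∀ v ∈ R, G.priority v < b) ∨
    (P = .dis ∧ ∃ ω, G.IsMeanPayoffWinning .dis R ω)

theorem hasStrategyDecomposition_of_trap {P : Player} {b : ℕ} {W U T R : Set V} {τ : V → V}
    (hW : G.IsSubgameWithTop b W) (hP : GoodParity P.opp b) (hpart : IsPartition W U T R)
    (hne : R.Nonempty) (hR : G.IsRecurrent P b R) (hT : G.IsReachabilityStrategy P W T R τ)
    (hU : U.Nonempty → G.HasStrategyDecomposition U P) (htrap : G.IsTrap P.opp W R) :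
    G.HasStrategyDecomposition W P := by
  have hUW : U ⊆ W := by
    rw [← hpart.1, Set.union_assoc]
    exact Set.subset_union_left
  cases P with
  | con =>
    obtain ⟨⟨b', hb'⟩, hlt⟩ : G.HasStrategyDecomposition R .con ∧ ∀ v ∈ R, G.priority v < b := by
      simpa [IsRecurrent] using hR
    obtain ⟨b'', hle, hb''⟩ : ∃ b'', b'' ≤ b ∧ (U.Nonempty → G.ConDecomposition b'' U) := by
      by_cases hU' : U.Nonempty
      · obtain ⟨b'', h⟩ := hU hU'
        exact ⟨b'', hW.mono h.isSubgameWithTop hUW, fun _ => h⟩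
      -- An arbitrary admissible index for the empty part.
      · exact ⟨b, le_rfl, fun h => absurd h hU'⟩
    exact ⟨b, .even b W U T R τ b' b'' hW hP hpart hne (hb'.isSubgameWithTop.lt hlt) hb' hT hle
      hb'' htrap⟩
  | dis =>
    obtain ⟨b'', hle, hb''⟩ : ∃ b'', b'' ≤ b ∧ (U.Nonempty → G.DisDecomposition b'' U) := by
      by_cases hU' : U.Nonempty
      · obtain ⟨b'', h⟩ := hU hU'
        exact ⟨b'', hW.mono h.isSubgameWithTop hUW, fun _ => h⟩
      · exact ⟨b, le_rfl, fun h => absurd h hU'⟩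
    rcases hR with ⟨⟨b', hb'⟩, hlt⟩ | ⟨-, ω, hω⟩
    · exact ⟨b, .oddInduction b W U T R τ b' b'' hW hP hpart hne (hb'.isSubgameWithTop.lt hlt) hb'
        hT hle hb'' htrap⟩
    · exact ⟨b, .oddMeanPayoff b W U T R τ ω b'' hW hP hpart hne hω hT hle hb'' htrap⟩

theorem HasPotential.isMeanPayoffWinning [Finite V] {W : Set V} {l : V → V}
    (h : G.HasPotential .con W l) : G.IsMeanPayoffWinning .con W l := by
  obtain ⟨hpos, δ, g, hδ, hg⟩ := h
  obtain ⟨K, -, hK⟩ := exists_abs_bound g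
  refine ⟨hpos, fun p hp hf => ?_⟩
  refine meanPayoff_neg_of_potential (Φ := fun n => g (p n)) hδ (fun n => (abs_le.1 (hK _)).1)
    fun n => ?_
  have := hg _ (hp n).1 _ (hp (n + 1)).1 (hp n).2 (hf n (hp n).1)
  simp only [weight] at this
  linarith

theorem hasStrategyDecomposition_of_top [Finite V] {P : Player} {b : ℕ} {W R T B : Set V}
    {τ l : V → V} (hW : G.IsSubgameWithTop b W) (hP : GoodParity P b)
    (hpart : IsPartition W R T B) (hB : B = {v ∈ W | G.priority v = b})
    (hT : G.IsReachabilityStrategy P W T B τ)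
    (hR : R.Nonempty → G.HasStrategyDecomposition R P) (hl : G.HasPotential P W l) :
    G.HasStrategyDecomposition W P := by
  have hne : B.Nonempty := by
    obtain ⟨v, hv, he⟩ := hW.2.1
    rw [hB]
    exact ⟨v, hv, he⟩
  have hlt : ∀ v ∈ R, G.priority v < b := by
    intro v hv
    have hvW := (hpart.mem_iff v).2 (Or.inl hv)
    refine lt_of_le_of_ne (hW.le hvW) fun he => ?_
    refine Set.disjoint_left.1 hpart.2.2.1 hv ?_
    rw [hB]
    exact ⟨hvW, he⟩
  cases P with
  | con =>
    obtain ⟨b', hlt, hb'⟩ : ∃ b', b' < b ∧ (R.Nonempty → G.ConDecomposition b' R) := by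
      by_cases hR' : R.Nonempty
      · obtain ⟨b', h⟩ := hR hR'
        exact ⟨b', h.isSubgameWithTop.lt hlt, fun _ => h⟩
      -- The index for an empty `R` only has to be less than `b`; zero is, because priorities are
      -- positive.
      · exact ⟨0, hW.pos, fun h => absurd h hR'⟩
    exact ⟨b, .odd b W R T B τ l b' hW hP hpart hne hB hT hlt hb' hl.isMeanPayoffWinning⟩
  | dis =>
    obtain ⟨b', hlt, hb'⟩ : ∃ b', b' < b ∧ (R.Nonempty → G.DisDecomposition b' R) := by
      by_cases hR' : R.Nonempty
      · obtain ⟨b', h⟩ := hR hR'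
        exact ⟨b', h.isSubgameWithTop.lt hlt, fun _ => h⟩
      · exact ⟨0, hW.pos, fun h => absurd h hR'⟩
    exact ⟨b, .even b W R T B τ b' hW hP hpart hne hB hT hlt hb'⟩

/-! ### Solving subgames -/

variable (G) in
/-- The subgame `W` splits into parts `X P` that the players `P` win and where they have strategy
decompositions. -/
def IsSolution (W : Set V) (X : Player → Set V) : Prop :=
  ∀ P, X P ∪ X P.opp = W ∧ Disjoint (X P) (X P.opp) ∧ G.IsTrap P.opp W (X P) ∧
    ((X P).Nonempty → G.HasStrategyDecomposition (X P) P) ∧ G.Wins P (X P)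

theorem isSolution_pair {P : Player} {W Y Z : Set V} (hYZ : Y ∪ Z = W) (hd : Disjoint Y Z)
    (hY : G.IsTrap P.opp W Y) (hZ : G.IsTrap P W Z)
    (hYd : Y.Nonempty → G.HasStrategyDecomposition Y P)
    (hZd : Z.Nonempty → G.HasStrategyDecomposition Z P.opp) (hYw : G.Wins P Y)
    (hZw : G.Wins P.opp Z) : ∃ X, G.IsSolution W X := by
  cases P with
  | con =>
    refine ⟨fun | .con => Y | .dis => Z, ?_⟩
    rintro (_ | _)
    · exact ⟨hYZ, hd, hY, hYd, hYw⟩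
    · exact ⟨(Set.union_comm _ _).trans hYZ, hd.symm, hZ, hZd, hZw⟩
  | dis =>
    refine ⟨fun | .con => Z | .dis => Y, ?_⟩
    rintro (_ | _)
    · exact ⟨(Set.union_comm _ _).trans hYZ, hd.symm, hZ, hZd, hZw⟩
    · exact ⟨hYZ, hd, hY, hYd, hYw⟩

theorem isSolution_single {P : Player} {W : Set V} (hW : G.IsTrap P.opp W W)
    (hd : W.Nonempty → G.HasStrategyDecomposition W P) (hw : G.Wins P W) :
    ∃ X, G.IsSolution W X :=
  isSolution_pair (Set.union_empty W) (Set.disjoint_empty W) hW (isTrap_empty P W) hd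
    (fun h => absurd rfl h.ne_empty) hw (wins_empty _)

theorem exists_isSolution_of_ssubset {W U : Set V} {P : Player}
    (ih : ∀ Z ⊂ W, G.IsSubgame Z → ∃ X, G.IsSolution Z X) (hW : G.IsSubgame W)
    (hU : G.IsTrap P W U) (hne : U ≠ W) : ∃ X, G.IsSolution U X := by
  by_cases h : U.Nonempty
  · exact ih U (hU.1.ssubset_of_ne hne) (hU.isSubgame hW h)
  · rw [Set.not_nonempty_iff_eq_empty] at h
    subst h
    exact isSolution_single (P := .con) (isTrap_empty _ _) (fun h => absurd rfl h.ne_empty)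
      (wins_empty _)

theorem IsSolution.eq_of_opp_eq_empty {W : Set V} {X : Player → Set V} (hX : G.IsSolution W X)
    {P : Player} (h : X P.opp = ∅) : X P = W := by
  have := (hX P).1
  rwa [h, Set.union_empty] at this

/-- `P` attracts to `R`, and the rest `U` is solved by induction. If `P` wins all of `U`, then `P`
wins `W`. Otherwise the opponent's part of `U` is a trap for `P` in `W`, and its complement `Y` is a
proper trap for the opponent that `P` wins. -/
theorem exists_isSolution_of_trap [Finite V] {P : Player} {b : ℕ} {W R : Set V}
    (ih : ∀ Z ⊂ W, G.IsSubgame Z → ∃ X, G.IsSolution Z X) (hW : G.IsSubgameWithTop b W)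
    (hP : GoodParity P.opp b) (htrap : G.IsTrap P.opp W R) (hne : R.Nonempty)
    (hR : G.IsRecurrent P b R) (hwin : G.Wins P R) : ∃ X, G.IsSolution W X := by
  obtain ⟨U, T, τ, rank, hpart, hT, hU⟩ := hW.1.exists_attractor P R htrap.1
  obtain ⟨hunion, hUT, hUR, hTR⟩ := id hpart
  have hUne : U ≠ W := by
    rintro rfl
    obtain ⟨x, hx⟩ := hne
    exact Set.disjoint_left.1 hUR (htrap.1 hx) hx
  obtain ⟨X, hX⟩ := exists_isSolution_of_ssubset ih hW.1 hU hUne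
  by_cases hZ : X P.opp = ∅
  · have hXU := hX.eq_of_opp_eq_empty hZ
    obtain ⟨-, -, -, hd, hw⟩ := hX P
    rw [hXU] at hd hw
    exact isSolution_single (hW.1.isTrap_self _) (fun _ => hasStrategyDecomposition_of_trap hW hP
      hpart hne hR hT.isReachabilityStrategy hd htrap) (hw := hwin.of_trap hpart htrap hT hw)
  · obtain ⟨hXU, hXd, hXt, hXdec, hXw⟩ := hX P
    obtain ⟨-, -, hXt', hXdec', hXw'⟩ := hX P.opp
    rw [P.opp_opp] at hXt'
    have hXsub : X P ⊆ U := hXt.1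
    have hXsub' : X P.opp ⊆ U := hXt'.1
    set Y := X P ∪ T ∪ R with hY
    have hpartY : IsPartition Y (X P) T R :=
      ⟨rfl, hUT.mono_left hXsub, hUR.mono_left hXsub, hTR⟩
    have hYd : Disjoint Y (X P.opp) :=
      Disjoint.union_left (Disjoint.union_left hXd (hUT.mono_left hXsub').symm)
        (hUR.mono_left hXsub').symm
    have hYX : Y ∪ X P.opp = W := by
      rw [← hunion, ← hXU]
      ext v
      simp only [hY, Set.mem_union]
      tauto
    have hYW : Y ⊆ W := hYX ▸ Set.subset_union_left
    have hTY : T ⊆ Y := fun v hv => Or.inl (Or.inr hv)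
    have hRY : R ⊆ Y := fun v hv => Or.inr hv
    have hXY : X P ⊆ Y := fun v hv => Or.inl (Or.inl hv)
    have hYtrap : G.IsTrap P.opp W Y := by
      refine ⟨hYW, fun v hv => ⟨fun ho u hu he => ?_, fun ho => ?_⟩⟩
      · rcases (hpartY.mem_iff v).1 hv with hv | hv | hv
        · rcases (hpart.mem_iff u).1 hu with hu | hu | hu
          · exact hXY ((hXt.2 v hv).1 ho u hu he)
          · exact hTY hu
          · exact hRY hu
        · rcases hT.decrease v hv u hu he fun h => absurd h (Player.ne_iff.2 ho) with h | h
          · exact hRY h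
          · exact hTY h.1
        · exact hRY ((htrap.2 v hv).1 ho u hu he)
      · rcases (hpartY.mem_iff v).1 hv with hv | hv | hv
        · obtain ⟨u, hu, he⟩ := (hXt.2 v hv).2 ho
          exact ⟨u, hXY hu, he⟩
        · obtain ⟨h1, h2⟩ := hT.positional v hv (Player.ne_opp_iff.1 ho)
          refine ⟨τ v, ?_, h2⟩
          rcases hT.decrease v hv _ h1 h2 fun _ => rfl with h | h
          · exact hRY h
          · exact hTY h.1
        · obtain ⟨u, hu, he⟩ := (htrap.2 v hv).2 ho
          exact ⟨u, hRY hu, he⟩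
    have hYwin : G.Wins P Y :=
      hwin.of_trap hpartY (htrap.mono hYW hRY) (hT.mono hYW hTY hRY) hXw
    have hYne : Y ≠ W := by
      intro h
      obtain ⟨x, hx⟩ := Set.nonempty_iff_ne_empty.2 hZ
      exact Set.disjoint_left.1 hYd (h ▸ hU.1 (hXsub' hx)) hx
    -- The biggest priority of `Y` may differ from `b`, so the partition of `Y` need not be a
    -- decomposition. Instead `Y` is solved afresh: the opponent's part is a trap for `P`, who wins
    -- on `Y`, so it is empty and `P` has a decomposition of all of `Y`.
    obtain ⟨X', hX'⟩ := exists_isSolution_of_ssubset ih hW.1 hYtrap hYne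
    obtain ⟨-, -, ht', -, hw'⟩ := hX' P.opp
    rw [P.opp_opp] at ht'
    have hX'Y := hX'.eq_of_opp_eq_empty (hYwin.eq_empty_of_isTrap hw' ht')
    have hYdec := (hX' P).2.2.2.1
    rw [hX'Y] at hYdec
    exact isSolution_pair hYX hYd hYtrap (hU.trans hXt') hYdec hXdec' hYwin hXw'

/-- Outside the attractor to the top priority, either `P` wins everywhere and `Wins.of_top` applies,
or the opponent wins a non-empty trap with priorities below `b`. In the second case
`exists_isSolution_of_trap` applies with the players exchanged. -/
theorem exists_isSolution_of_top [Finite V] {P : Player} {b : ℕ} {W : Set V} {l : V → V}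
    (ih : ∀ Z ⊂ W, G.IsSubgame Z → ∃ X, G.IsSolution Z X) (hW : G.IsSubgameWithTop b W)
    (hP : GoodParity P b) (hl : G.HasPotential P W l) : ∃ X, G.IsSolution W X := by
  set B := {v ∈ W | G.priority v = b} with hB
  obtain ⟨R, T, τ, rank, hpart, hT, hR⟩ := hW.1.exists_attractor P B fun v hv => hv.1
  have hRne : R ≠ W := by
    rintro rfl
    obtain ⟨v, hv, he⟩ := hW.2.1
    exact Set.disjoint_left.1 hpart.2.2.1 hv ⟨hv, he⟩
  obtain ⟨X, hX⟩ := exists_isSolution_of_ssubset ih hW.1 hR hRne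
  by_cases hZ : X P.opp = ∅
  · have hXR := hX.eq_of_opp_eq_empty hZ
    obtain ⟨-, -, -, hd, hw⟩ := hX P
    rw [hXR] at hd hw
    exact isSolution_single (hW.1.isTrap_self _) (fun _ => hasStrategyDecomposition_of_top hW hP
      hpart hB hT.isReachabilityStrategy hd hl)
      (hw := .of_top (fun v hv => hW.le hv) hP hpart (fun v hv => hv.2) hT hw hl)
  · have hZne := Set.nonempty_iff_ne_empty.2 hZ
    obtain ⟨-, -, ht, hd, hw⟩ := hX P.opp
    rw [P.opp_opp] at ht
    refine exists_isSolution_of_trap (P := P.opp) ih hW (by rwa [P.opp_opp])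
      (by rw [P.opp_opp]; exact hR.trans ht) hZne (Or.inl ⟨hd hZne, fun v hv => ?_⟩) hw
    have hvR := ht.1 hv
    refine lt_of_le_of_ne (hW.le (hR.1 hvR)) fun he => ?_
    exact Set.disjoint_left.1 hpart.2.2.1 hvR ⟨hR.1 hvR, he⟩

theorem IsMeanPayoffWinning.wins {R : Set V} {ω : V → V} (h : G.IsMeanPayoffWinning .dis R ω) :
    G.Wins .dis R :=
  ⟨1, one_pos, ⟨Unit, (), fun _ => ω, fun _ _ => ()⟩, fun _ _ => 0, 0, fun _ v hv => h.1 v hv,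
    fun _ _ _ => le_rfl, fun _ _ _ => le_rfl, fun _ _ _ _ _ _ _ => by norm_num [weight],
    fun p _ hp hp' => not_lt.2 (h.2 p hp.isPlay fun n _ => hp.follows n) hp'.2⟩

open Classical in
/-- Either Con has a positional strategy with a potential on the whole subgame, or Dis has a
positional mean-payoff winning strategy on a non-empty trap for Con. -/
theorem IsSubgame.meanPayoff_dichotomy [Finite V] {W : Set V} (hW : G.IsSubgame W) :
    (∃ l, G.HasPotential .con W l) ∨
      ∃ R ω, R.Nonempty ∧ G.IsTrap .con W R ∧ G.IsMeanPayoffWinning .dis R ω := by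
  have := Fintype.ofFinite V
  -- Vertices outside `W` receive a loop, so that every vertex has a successor and no edge leads out
  -- of `W`.
  let S : V → Finset V := fun v => if v ∈ W then Finset.univ.filter (fun u => u ∈ W ∧ G.Edge v u) else {v}
  have hS : ∀ v ∈ W, ∀ u, u ∈ S v ↔ u ∈ W ∧ G.Edge v u := fun v hv u => by simp [S, hv]
  have hSne : ∀ v, (S v).Nonempty := by
    intro v
    by_cases hv : v ∈ W
    · obtain ⟨u, hu⟩ := hW.2 v hv
      exact ⟨u, (hS v hv u).2 hu⟩
    · simp [S, hv]
  obtain ⟨ε, hε, X, ⟨h, hX⟩, g, hY⟩ := exists_potentialDetermined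
    (fun v => G.owner v = .dis) (fun v u => (G.cost v u : ℝ)) S hSne
  rcases (X ∩ W).eq_empty_or_nonempty with hempty | hne
  · left
    have hWX : ∀ v ∈ W, v ∈ Xᶜ := fun v hv hx => by
      have : v ∈ X ∩ W := ⟨hx, hv⟩
      rw [hempty] at this
      exact this
    have hmove : ∀ v, ∃ u, v ∈ W → G.owner v = .con →
        (u ∈ W ∧ G.Edge v u) ∧ g v ≤ -G.cost v u - ε + g u := by
      intro v
      by_cases hv : v ∈ W ∧ G.owner v = .con
      · obtain ⟨u, hu, -, hle⟩ := (hY v (hWX v hv.1)).1 (by simp [hv.2])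
        exact ⟨u, fun _ _ => ⟨(hS v hv.1 u).1 hu, hle⟩⟩
      · exact ⟨v, fun h1 h2 => absurd ⟨h1, h2⟩ hv⟩
    choose l hl using hmove
    -- `HasPotential` uses its margin twice for Con, once inside the weight and once as the gain per
    -- step, so `ε` is halved.
    refine ⟨l, fun v hv ho => (hl v hv ho).1, ε / 2, fun v => -g v, by linarith,
      fun v hv u hu he hf => ?_⟩
    have : g v ≤ -G.cost v u - ε + g u := by
      by_cases ho : G.owner v = .con
      · rw [hf ho]
        exact (hl v hv ho).2
      · have ho' : G.owner v = .dis := Player.ne_iff.1 ho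
        exact ((hY v (hWX v hv)).2 (by simp [ho']) u ((hS v hv u).2 ⟨hu, he⟩)).2
    simp only [weight]
    linarith
  · right
    have hmove : ∀ v, ∃ u, v ∈ X ∩ W → G.owner v = .dis →
        (u ∈ X ∩ W ∧ G.Edge v u) ∧ h v ≤ G.cost v u + h u := by
      intro v
      by_cases hv : v ∈ X ∩ W ∧ G.owner v = .dis
      · obtain ⟨u, hu, huX, hle⟩ := (hX v hv.1.1).1 hv.2
        obtain ⟨huW, he⟩ := (hS v hv.1.2 u).1 hu
        exact ⟨u, fun _ _ => ⟨⟨⟨huX, huW⟩, he⟩, hle⟩⟩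
      · exact ⟨v, fun h1 h2 => absurd ⟨h1, h2⟩ hv⟩
    choose ω hω using hmove
    obtain ⟨K, -, hK⟩ := exists_abs_bound h
    have hcon : ∀ v ∈ X ∩ W, G.owner v ≠ .dis → ∀ u ∈ W, G.Edge v u →
        u ∈ X ∧ h v ≤ G.cost v u + h u := fun v hv ho u hu he =>
      (hX v hv.1).2 ho u ((hS v hv.2 u).2 ⟨hu, he⟩)
    refine ⟨X ∩ W, ω, hne, ⟨Set.inter_subset_right, fun v hv => ⟨fun ho u hu he =>
      ⟨(hcon v hv (by simp [ho]) u hu he).1, hu⟩, fun ho => ?_⟩⟩,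
      fun v hv ho => (hω v hv ho).1, fun p hp hf => ?_⟩
    · exact ⟨ω v, (hω v hv (Player.ne_iff.1 ho)).1⟩
    · refine meanPayoff_nonneg_of_potential (Φ := fun n => h (p n))
        (fun n => (abs_le.1 (hK _)).1) (fun n => (abs_le.1 (hK _)).2) fun n => ?_
      by_cases ho : G.owner (p n) = .dis
      · rw [hf n (hp n).1 ho]
        exact (hω _ (hp n).1 ho).2
      · exact (hcon _ (hp n).1 ho _ (hp (n + 1)).1.2 (hp n).2).2

theorem IsSubgame.exists_isSolution [Finite V] {W : Set V} (hW : G.IsSubgame W) :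
    ∃ X, G.IsSolution W X := by
  induction hn : W.ncard using Nat.strong_induction_on generalizing W with
  | _ n ih =>
  replace ih : ∀ Z ⊂ W, G.IsSubgame Z → ∃ X, G.IsSolution Z X := fun Z hZ hZs =>
    ih _ (hn ▸ Set.ncard_lt_ncard hZ (Set.toFinite _)) hZs rfl
  obtain ⟨v, hv, hmax⟩ := Set.exists_max_image W G.priority (Set.toFinite _) hW.1
  have htop : G.IsSubgameWithTop (G.priority v) W :=
    ⟨hW, ⟨v, hv, rfl⟩, by rintro - ⟨u, hu, rfl⟩; exact hmax u hu⟩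
  rcases Nat.even_or_odd (G.priority v) with heven | hodd
  · choose l hl using fun v : V => show ∃ u, v ∈ W → u ∈ W ∧ G.Edge v u by
      by_cases hv : v ∈ W
      · obtain ⟨u, hu⟩ := hW.2 v hv
        exact ⟨u, fun _ => hu⟩
      · exact ⟨v, fun h => absurd h hv⟩
    -- The weight `-1` of Dis cancels the margin `δ = 1`, so the zero potential works for any choice
    -- of edges inside `W`.
    exact exists_isSolution_of_top (P := .dis) ih htop heven ⟨fun v hv _ => hl v hv, 1, 0, one_pos,
      fun _ _ _ _ _ _ => by simp [weight]⟩
  · rcases hW.meanPayoff_dichotomy with ⟨l, hl⟩ | ⟨R, ω, hne, htrap, hω⟩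
    · exact exists_isSolution_of_top (P := .con) ih htop hodd hl
    · exact exists_isSolution_of_trap (P := .dis) ih htop hodd htrap hne (Or.inr ⟨rfl, ω, hω⟩)
        hω.wins

/-! ### Winning sets -/

open Classical in
theorem Wins.subset_winningSet {P : Player} {X : Set V} (h : G.Wins P X)
    (htrap : G.IsTrap P.opp Set.univ X) : X ⊆ G.winningSet 0 P := by
  obtain ⟨ε, hε, s, Φ, K, hs⟩ := h
  -- The edges `e` only make the strategy legal outside `X`, which no play from `X` reaches. Inside
  -- `X` the memory state is recomputed from the history.
  choose e he using G.exists_edge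
  let mem : List V → s.Memory := fun h => h.foldl s.update s.start
  refine fun x hx => ⟨fun h v => if v ∈ X then s.move (mem h) v else e v, fun h v ho => ?_,
    fun p hp h0 hf => ?_⟩
  · by_cases hv : v ∈ X
    · simpa [hv] using (hs.move _ v hv ho).2
    · simpa [hv] using he v
  · have hmove : ∀ n, p n ∈ X → G.owner (p n) = P →
        p (n + 1) = s.move (mem ((List.range n).map p)) (p n) := fun n hn ho =>
      (hf n ho).trans (if_pos hn)
    have hX : ∀ n, p n ∈ X := by
      intro n
      induction n with
      | zero => exact h0 ▸ hx
      | succ n ih =>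
        by_cases ho : G.owner (p n) = P
        · rw [hmove n ih ho]
          exact (hs.move _ _ ih ho).1
        · exact (htrap.2 _ ih).1 (Player.ne_iff.1 ho) _ (Set.mem_univ _) (hp n).2
    refine hs.winsPlay hε (m := fun n => mem ((List.range n).map p))
      ⟨fun n => ⟨hX n, (hp n).2⟩, fun n => ?_, fun n => hmove n (hX n)⟩
    simp [mem, List.range_succ]

open Classical in
theorem WinsFrom.not_opp {θ : ℚ} {P : Player} {v : V} (h : G.WinsFrom θ P v) :
    ¬ G.WinsFrom θ P.opp v := by
  rintro ⟨σ', hσ', hw'⟩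
  obtain ⟨σ, hσ, hw⟩ := h
  -- The two strategies are played against each other, carrying the history along; the resulting
  -- play would be won by both players.
  let step : List V × V → List V × V := fun a =>
    (a.1 ++ [a.2], if G.owner a.2 = P then σ a.1 a.2 else σ' a.1 a.2)
  let a : ℕ → List V × V := fun n => step^[n] ([], v)
  have ha : ∀ n, a (n + 1) = step (a n) := fun n => Function.iterate_succ_apply' _ _ _
  have hist : ∀ n, (a n).1 = (List.range n).map fun i => (a i).2 := by
    intro n
    induction n with
    | zero => rfl
    | succ n ih => rw [ha, List.range_succ, List.map_append, ← ih]; rfl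
  have hplay : G.IsPlay Set.univ fun n => (a n).2 := by
    refine fun n => ⟨Set.mem_univ _, ?_⟩
    simp only [ha, step]
    split_ifs with ho
    · exact hσ _ _ ho
    · exact hσ' _ _ (Player.ne_iff.1 ho)
  refine not_winsPlay_opp (hw (fun n => (a n).2) hplay rfl fun n ho => ?_)
    (hw' _ hplay rfl fun n ho => ?_)
  · rw [← hist n]
    simp only [ha, step, if_pos ho]
  · rw [← hist n]
    simp only [ha, step, if_neg (Player.ne_iff.2 ho)]

theorem exists_isSolution_univ [Finite V] (G : MeanPayoffParityGame V) :
    ∃ X, G.IsSolution Set.univ X ∧ ∀ P, X P = G.winningSet 0 P := by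
  obtain ⟨X, hX⟩ : ∃ X, G.IsSolution Set.univ X := by
    rcases isEmpty_or_nonempty V with hV | hV
    · rw [Set.univ_eq_empty_iff.2 hV]
      exact isSolution_single (P := .con) (isTrap_empty _ _) (fun h => absurd rfl h.ne_empty)
        (wins_empty _)
    · refine IsSubgame.exists_isSolution ⟨Set.univ_nonempty, fun v _ => ?_⟩
      obtain ⟨u, hu⟩ := G.exists_edge v
      exact ⟨u, Set.mem_univ _, hu⟩
  have hsub : ∀ P, X P ⊆ G.winningSet 0 P := fun P =>
    (hX P).2.2.2.2.subset_winningSet (hX P).2.2.1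
  refine ⟨X, hX, fun P => (hsub P).antisymm fun v hv => ?_⟩
  have hmem : v ∈ X P ∪ X P.opp := (hX P).1 ▸ Set.mem_univ v
  exact hmem.resolve_right fun h => WinsFrom.not_opp hv (hsub _ h)

theorem xor_winsFrom_zero [Finite V] (G : MeanPayoffParityGame V) (v : V) :
    Xor (G.WinsFrom 0 .dis v) (G.WinsFrom 0 .con v) := by
  obtain ⟨X, hX, hwin⟩ := G.exists_isSolution_univ
  have hmem : v ∈ X .dis ∪ X .con := (hX .dis).1 ▸ Set.mem_univ v
  rw [hwin, hwin] at hmem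
  rcases hmem with h | h
  · exact Or.inl ⟨h, WinsFrom.not_opp h⟩
  · exact Or.inr ⟨h, WinsFrom.not_opp h⟩

end MeanPayoffParityGame

theorem mainTheorem4 {V : Type*} [Finite V] (G : MeanPayoffParityGame V) :
    (∃ WDis WCon : Set V,
      WDis ∪ WCon = Set.univ ∧ Disjoint WDis WCon ∧
      G.IsTrap .con Set.univ WDis ∧ G.IsTrap .dis Set.univ WCon ∧
      (WDis.Nonempty → G.HasStrategyDecomposition WDis .dis) ∧
      (WCon.Nonempty → G.HasStrategyDecomposition WCon .con) ∧
      WDis = G.winningSet 0 .dis ∧ WCon = G.winningSet 0 .con) ∧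
    (∀ (θ : ℚ) (v : V), Xor (G.WinsFrom θ .dis v) (G.WinsFrom θ .con v)) := by
  obtain ⟨X, hX, hwin⟩ := G.exists_isSolution_univ
  obtain ⟨hu, hd, ht, hdec, -⟩ := hX .dis
  obtain ⟨-, -, ht', hdec', -⟩ := hX .con
  refine ⟨⟨X .dis, X .con, hu, hd, ht, ht', hdec, hdec', hwin _, hwin _⟩, fun θ v => ?_⟩
  rw [← G.winsFrom_shiftThreshold θ, ← G.winsFrom_shiftThreshold θ]
  exact (G.shiftThreshold θ).xor_winsFrom_zero v
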